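/- For $n,j,k,m\in\mathbb N=\{0,1,2,\dots\}$ let $S_{njkm}=\min(n,j,k,m)+1$. For $\lambda,\omega\in\mathbb R$ consider the system $$(n+1)(\lambda-n\omega)A_n=\sum_{j=0}^{\infty}\sum_{k=0}^{n+j}S_{n,j,k,n+j-k}\,A_jA_kA_{n+j-k},\qquad n\in\mathbb N, \tag{1}$$ for real sequences $A=(A_n)_{n\in\mathbb N}\in\ell^2(\mathbb N)$; a solution is an $A\in\ell^2(\mathbb N)$ for which the series in $j$ converge and (1) is an identity between elements of $\ell^2(\mathbb N)$, i.e. $\big((n+1)(\lambda-n\omega)A_n\big)_n\in\ell^2(\mathbb N)$. Throughout $\lambda=1+\omega$; then the second eigenmode $e_1=(\delta_{n1})_n$ is a solution for every $\omega$. Put $\omega_*=\tfrac1{15}$. **Theorem.** Exactly two branches of solutions $(\omega,A)\in\mathbb R\times\ell^2(\mathbb N)$ of (1) with $\lambda-\omega=1$ bifurcate from $e_1$ at $\omega_*$. Precisely, there are $r>0$, $\eta>0$, $C$, and two families of solutions, $(\omega,A)=(\omega_1(\mu),A_1(\mu))$, $|\mu|<r$, and $(\omega,A)=(\omega_2(\varepsilon),A_2(\varepsilon))$,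 $|\varepsilon|<r$, each $C^\infty$ as a map into $\mathbb R\times\ell^2(\mathbb N)$, such that, writing $\varepsilon=A_4$ and $\mu=A_{11}$ for the amplitudes of the modes $4$ and $11$, (i) $\varepsilon=0$ along the first family, which is parameterized by $\mu$, and (ii) $\mu=0$ along the second family, which is parameterized by $\varepsilon$, and along both families $$|\omega-\omega_*|+\sup_{n\in\mathbb N}\big|A_n-\delta_{n1}-\varepsilon\,\delta_{n4}-\mu\,\delta_{n,11}\big|\le C(\varepsilon^2+\mu^2).$$ Moreover, a pair $(\omega,A)\in\mathbb R\times\ell^2(\mathbb N)$ with $|\omega-\omega_*|<\eta$ and $\|A-e_1\|_{\ell^2}<\eta$ solves (1) with $\lambda=1+\omega$ if and only if $A=e_1$, or $(\omega,A)$ lies on the first family with $\mu\ne0$, or $(\omega,A)$ lies on the second family with $\varepsilon\ne0$. In particular, no such solution has both $\varepsilon=A_4\neq0$ and $\mu=A_{11}\ne0$. -/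

import Mathlib

/-- The real Hilbert space `ℓ²(ℕ)`. -/
abbrev Ell2 : Type := lp (fun _ : ℕ => ℝ) 2

/-- The interaction coefficient `S_{njkm} = min (n, j, k, m) + 1`. -/
def interaction (n j k m : ℕ) : ℕ := min (min n j) (min k m) + 1

/-- The `j`-th term of the outer series of the cubic nonlinearity in the `n`-th equation,
`∑_{k=0}^{n+j} S_{n,j,k,n+j-k} A_j A_k A_{n+j-k}`
(the index `n + j - k` is a genuine subtraction, since `k ≤ n + j`). -/
def cubicTerm (A : ℕ → ℝ) (n j : ℕ) : ℝ :=
  ∑ k ∈ Finset.range (n + j + 1),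
    (interaction n j k (n + j - k) : ℝ) * A j * A k * A (n + j - k)

/-- `A ∈ ℓ²(ℕ)` is a (real) stationary state of the cubic conformal flow with parameters
`(lam, ω)`:
`(n+1) (lam - n ω) A_n = ∑_{j ≥ 0} ∑_{k=0}^{n+j} S_{n,j,k,n+j-k} A_j A_k A_{n+j-k}`, `n ∈ ℕ`,
where each series converges and the system is an identity between elements of `ℓ²(ℕ)`, that is,
`A` lies in the domain of the diagonal operator on the left-hand side
(the weighted space `ℓ^{2,2}(ℕ)` if `ω ≠ 0`). -/
structure IsStationaryState (lam ω : ℝ) (A : Ell2) : Prop where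
  memℓp : Memℓp (fun n : ℕ => ((n : ℝ) + 1) * (lam - n * ω) * A n) 2
  hasSum : ∀ n : ℕ, HasSum (cubicTerm A n) (((n : ℝ) + 1) * (lam - n * ω) * A n)

/-- The second eigenmode `A_n = δ_{n1}`. -/
noncomputable def secondMode : Ell2 := lp.single 2 1 (1 : ℝ)

/-- The Kronecker symbol `δ_{nm}`. -/
def kronecker (n m : ℕ) : ℝ := if n = m then 1 else 0

/-- `s ↦ (ω s, A s)`, `|s| < r`, is a smooth branch of stationary states with `lam - ω = 1`,
bifurcating from the second eigenmode at `ω = 1/15`, along which the amplitudes of the modes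
`n = 4` and `n = 11` are `ε s` and `μ s`, and with
`|ω - 1/15| + sup_n |A_n - δ_{n1} - ε δ_{n4} - μ δ_{n,11}| ≤ C (ε² + μ²)`.
(The supremum is finite because `A s ∈ ℓ²(ℕ)`.) -/
structure IsSmoothBranch (r C : ℝ) (ε μ : ℝ → ℝ) (ω : ℝ → ℝ) (A : ℝ → Ell2) : Prop where
  smooth_ω : ContDiffOn ℝ ((⊤ : ℕ∞) : WithTop ℕ∞) ω (Set.Ioo (-r) r)
  smooth_A : ContDiffOn ℝ ((⊤ : ℕ∞) : WithTop ℕ∞) A (Set.Ioo (-r) r)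
  stationary : ∀ s ∈ Set.Ioo (-r) r, IsStationaryState (1 + ω s) (ω s) (A s)
  mode_four : ∀ s ∈ Set.Ioo (-r) r, A s 4 = ε s
  mode_eleven : ∀ s ∈ Set.Ioo (-r) r, A s 11 = μ s
  bound : ∀ s ∈ Set.Ioo (-r) r,
    |ω s - 1 / 15| +
      ⨆ n : ℕ, |A s n - kronecker n 1 - ε s * kronecker n 4 - μ s * kronecker n 11|
      ≤ C * (ε s ^ 2 + μ s ^ 2)

/-! Divide the n-th equation, with λ = 1 + ω, by (n+1)². Since S ≤ n+1, the nonlinearity becomes a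
bounded trilinear map T on ℓ¹(ℕ), and bifurcation can be studied there with bounded operators. The
domain condition puts every ℓ² solution in ℓ¹. Closeness to e_1 in ℓ² is upgraded to closeness in ℓ¹
by an energy estimate (`exists_near_of_isStationaryState`), which rests on the identity ∑_{k+m=n+j}
S = (n+1)(j+1).

At ω = 1/15 the linearization L at e_1 acts on e_n, n ≥ 3, as -(n-4)(n-11)/(15(n+1)²), and it is
invertible on the modes 0, 1, 2. Its kernel is spanned by e_4 and e_11, and off the kernel it has a
bounded inverse G. Lyapunov–Schmidt (`lyapunovSchmidt`) leaves an equation off the kernel and two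
scalar equations in s = A_4, t = A_11 and Δ = ω - 1/15.

The resonance n+j = k+m preserves sequences supported on n ≡ 1 mod d. Now 4 ≡ 1 mod 3 but 11 is not,
and 11 ≡ 1 mod 10 but 4 is not. Hence the equation of mode 4 is divisible by s and that of mode 11
by t. After division, with ρ = |s|+|t|, they read Δ = -(7/15)s² - (14/15)t² + O(ρ³) and Δ =
-(7/60)s² - (7/255)t² + O(ρ³). If s and t are both nonzero, both hold, and their difference (7/20)s²
+ (77/85)t² = O(ρ³) is impossible near 0 (`Auxiliary.not_mixed`). If one amplitude vanishes, its own
equation is automatic, and the other, rescaled, is solved uniquely by the implicit function theorem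
(`IsKernelPair.exists_branch`). -/

open Filter Topology

set_option maxSynthPendingDepth 3

/-- The Banach space `ℓ¹(ℕ)`. -/
abbrev Ell1 : Type := lp (fun _ : ℕ => ℝ) 1

theorem norm_trilinear_le {E F : Type*} [NormedAddCommGroup E] [NormedSpace ℝ E]
    [NormedAddCommGroup F] [NormedSpace ℝ F] (f : E →L[ℝ] E →L[ℝ] E →L[ℝ] F) (hf : ‖f‖ ≤ 1)
    (x y z : E) : ‖f x y z‖ ≤ ‖x‖ * ‖y‖ * ‖z‖ := by
  refine ((f x y).le_opNorm z).trans ?_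
  gcongr
  refine ((f x).le_opNorm y).trans ?_
  gcongr
  refine (f.le_opNorm x).trans ?_
  nlinarith [norm_nonneg x]

/-! ### Bounded operators on ℓ¹ prescribed on unit vectors -/

namespace Ell1

/-- The unit vectors of `ℓ¹(ℕ)`. -/
noncomputable def e (n : ℕ) : Ell1 := lp.single 1 n (1 : ℝ)

theorem e_apply (n m : ℕ) : e n m = if m = n then 1 else 0 := by
  rw [e, lp.single_apply]
  by_cases h : m = n
  · subst h; simp
  · simp [h]

@[simp] theorem e_apply_self (n : ℕ) : e n n = 1 := by simp [e_apply]

theorem e_apply_ne {n m : ℕ} (h : m ≠ n) : e n m = 0 := by simp [e_apply, h]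

@[simp] theorem norm_e (n : ℕ) : ‖e n‖ = 1 := by
  rw [e, lp.norm_single (by norm_num)]; simp

theorem hasSum_smul_e (x : Ell1) : HasSum (fun n => x n • e n) x := by
  have h := lp.hasSum_single (p := 1) (by norm_num) x
  have h2 : (fun n => x n • e n) = fun n => lp.single 1 n (x n) := by
    funext n
    rw [e, ← lp.single_smul]; simp
  rwa [h2]

theorem abs_apply_le (x : Ell1) (n : ℕ) : |x n| ≤ ‖x‖ := by
  simpa using lp.norm_apply_le_norm (by norm_num) x n

theorem hasSum_abs (x : Ell1) : HasSum (fun n => |x n|) ‖x‖ := by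
  simpa using lp.hasSum_norm (p := 1) (by norm_num) x

theorem clm_ext {Y : Type*} [NormedAddCommGroup Y] [NormedSpace ℝ Y] {f g : Ell1 →L[ℝ] Y} (h : ∀ n, f (e n) = g (e n)) : f = g := by
  ext x
  have h1 := f.hasSum (hasSum_smul_e x)
  have h2 := g.hasSum (hasSum_smul_e x)
  refine h1.unique ?_
  convert! h2 using 2 with n
  simp [h]

section Lift

variable {Y : Type*} [NormedAddCommGroup Y] [NormedSpace ℝ Y] [CompleteSpace Y]

theorem summable_smul (t : ℕ → Y) {C : ℝ} (h : ∀ i, ‖t i‖ ≤ C) (x : Ell1) :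
    Summable fun i => x i • t i := by
  refine Summable.of_norm_bounded ((hasSum_abs x).summable.mul_right C) fun i => ?_
  rw [norm_smul, Real.norm_eq_abs]
  exact mul_le_mul_of_nonneg_left (h i) (abs_nonneg _)

/-- The bounded linear map on `ℓ¹(ℕ)` sending the unit vectors to a given bounded family. -/
noncomputable def lift (t : ℕ → Y) {C : ℝ} (h : ∀ i, ‖t i‖ ≤ C) : Ell1 →L[ℝ] Y :=
  LinearMap.mkContinuous
    { toFun := fun x => ∑' i, x i • t i
      map_add' := fun x y => by
        rw [← (summable_smul t h x).tsum_add (summable_smul t h y)]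
        simp [add_smul]
      map_smul' := fun c x => by
        rw [RingHom.id_apply, ← (summable_smul t h x).tsum_const_smul]
        simp [mul_smul] } C fun x => by
      refine tsum_of_norm_bounded ((hasSum_abs x).mul_left C) fun i => ?_
      rw [norm_smul, Real.norm_eq_abs, mul_comm]
      exact mul_le_mul_of_nonneg_right (h i) (abs_nonneg _)

theorem lift_hasSum (t : ℕ → Y) {C : ℝ} (h : ∀ i, ‖t i‖ ≤ C) (x : Ell1) :
    HasSum (fun i => x i • t i) (lift t h x) := (summable_smul t h x).hasSum

theorem norm_lift_le (t : ℕ → Y) {C : ℝ} (h : ∀ i, ‖t i‖ ≤ C) : ‖lift t h‖ ≤ C :=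
  LinearMap.mkContinuous_norm_le _ ((norm_nonneg _).trans (h 0)) _

@[simp] theorem lift_e (t : ℕ → Y) {C : ℝ} (h : ∀ i, ‖t i‖ ≤ C) (n : ℕ) :
    lift t h (e n) = t n := by
  refine (lift_hasSum t h (e n)).unique ?_
  have h1 := hasSum_single (f := fun i => e n i • t i) n fun i hi => by
    rw [e_apply_ne hi, zero_smul]
  simpa using h1

end Lift

/-- The coordinate functionals of `ℓ¹(ℕ)`. -/
noncomputable def coord (n : ℕ) : Ell1 →L[ℝ] ℝ := lp.evalCLM ℝ (fun _ : ℕ => ℝ) 1 n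

@[simp] theorem coord_apply (n : ℕ) (x : Ell1) : coord n x = x n := rfl

theorem smul_e_norm_le {c C : ℝ} (h : |c| ≤ C) (n : ℕ) : ‖c • e n‖ ≤ C := by
  simpa [norm_smul] using h

/-- The diagonal operator with a given bounded diagonal. -/
noncomputable def diag (c : ℕ → ℝ) {C : ℝ} (h : ∀ n, |c n| ≤ C) : Ell1 →L[ℝ] Ell1 :=
  lift (fun n => c n • e n) fun n => smul_e_norm_le (h n) n

@[simp] theorem diag_e (c : ℕ → ℝ) {C : ℝ} (h : ∀ n, |c n| ≤ C) (n : ℕ) :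
    diag c h (e n) = c n • e n := lift_e _ _ _

@[simp] theorem diag_apply (c : ℕ → ℝ) {C : ℝ} (h : ∀ n, |c n| ≤ C) (x : Ell1) (n : ℕ) :
    diag c h x n = c n * x n := by
  have h1 : (coord n).comp (diag c h) = c n • coord n := by
    refine clm_ext fun m => ?_
    by_cases hm : n = m
    · subst hm; simp
    · simp [e_apply_ne hm]
  simpa using congrArg (fun f : Ell1 →L[ℝ] ℝ => f x) h1

theorem norm_diag_le (c : ℕ → ℝ) {C : ℝ} (h : ∀ n, |c n| ≤ C) : ‖diag c h‖ ≤ C :=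
  norm_lift_le _ _

/-- The inclusion of `ℓ¹(ℕ)` in `ℓ²(ℕ)`. -/
noncomputable def toEll2 : Ell1 →L[ℝ] Ell2 :=
  lift (C := 1) (fun n => (lp.single 2 n (1 : ℝ) : Ell2)) fun n => by
    rw [lp.norm_single (by norm_num)]; simp

@[simp] theorem toEll2_apply (x : Ell1) (n : ℕ) : toEll2 x n = x n := by
  have h1 : (lp.evalCLM ℝ (fun _ : ℕ => ℝ) 2 n).comp toEll2 = coord n := by
    refine clm_ext fun m => ?_
    rw [ContinuousLinearMap.comp_apply, toEll2, lift_e, coord_apply, e, lp.coeFn_single]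
    exact congrFun (lp.coeFn_single (E := fun _ : ℕ => ℝ) 2 m (1 : ℝ)) n
  exact congrArg (fun f : Ell1 →L[ℝ] ℝ => f x) h1

theorem toEll2_e_one : toEll2 (e 1) = secondMode := by
  simp [toEll2, secondMode]

/-! ### Resonant trilinear maps -/

section Tri

/-- The value of the resonant trilinear form on unit vectors. -/
noncomputable def triVal (w : ℕ → ℕ → ℕ → ℝ) (j k m : ℕ) : Ell1 :=
  if j ≤ k + m then w j k m • e (k + m - j) else 0

variable {w : ℕ → ℕ → ℕ → ℝ}

theorem norm_triVal_le (h : ∀ j k m, |w j k m| ≤ 1) (j k m : ℕ) : ‖triVal w j k m‖ ≤ 1 := by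
  unfold triVal
  split_ifs
  · exact smul_e_norm_le (h j k m) _
  · simp

/-- The bounded trilinear map on `ℓ¹(ℕ)` with resonance condition `n + j = k + m`. -/
noncomputable def tri (w : ℕ → ℕ → ℕ → ℝ) (h : ∀ j k m, |w j k m| ≤ 1) :
    Ell1 →L[ℝ] Ell1 →L[ℝ] Ell1 →L[ℝ] Ell1 :=
  lift (C := 1) (fun j => lift (C := 1) (fun k => lift (C := 1) (fun m => triVal w j k m)
    fun m => norm_triVal_le h j k m) fun _ => norm_lift_le _ _) fun _ => norm_lift_le _ _

@[simp] theorem tri_e (h : ∀ j k m, |w j k m| ≤ 1) (j k m : ℕ) :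
    tri w h (e j) (e k) (e m) = triVal w j k m := by
  simp [tri]

theorem norm_tri_le (h : ∀ j k m, |w j k m| ≤ 1) (x y z : Ell1) :
    ‖tri w h x y z‖ ≤ ‖x‖ * ‖y‖ * ‖z‖ :=
  norm_trilinear_le (E := Ell1) (F := Ell1) (tri w h) (norm_lift_le _ _) x y z

theorem tri_e_apply (h : ∀ j k m, |w j k m| ≤ 1) (j k n : ℕ) (z : Ell1) :
    tri w h (e j) (e k) z n = if k ≤ n + j then w j k (n + j - k) * z (n + j - k) else 0 := by
  have h1 := (coord n).hasSum (((tri w h (e j) (e k))).hasSum (hasSum_smul_e z))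
  simp only [map_smul, tri_e, coord_apply, smul_eq_mul] at h1
  refine h1.unique ?_
  have key : ∀ m, triVal w j k m n = if k ≤ n + j ∧ m = n + j - k then w j k m else 0 := by
    intro m
    unfold triVal
    by_cases hj : j ≤ k + m
    · rw [if_pos hj]
      by_cases hn : n = k + m - j
      · rw [if_pos (by omega)]; simp [hn]
      · rw [if_neg (by omega)]; simp [e_apply_ne hn]
    · rw [if_neg hj, if_neg (by omega)]; simp
  simp only [key]
  by_cases hk : k ≤ n + j
  · simp only [hk, true_and, if_true]
    have h2 := hasSum_single (f := fun m => z m * if m = n + j - k then w j k m else 0)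
      (n + j - k) fun m hm => by simp [hm]
    simpa [mul_comm] using h2
  · simp only [hk, false_and, if_false, mul_zero]
    exact hasSum_zero

theorem tri_apply_hasSum (h : ∀ j k m, |w j k m| ≤ 1) (x y z : Ell1) (n : ℕ) :
    HasSum (fun j => ∑ k ∈ Finset.range (n + j + 1),
      w j k (n + j - k) * x j * y k * z (n + j - k)) (tri w h x y z n) := by
  have h1 : ∀ j, tri w h (e j) y z n = ∑ k ∈ Finset.range (n + j + 1),
      w j k (n + j - k) * y k * z (n + j - k) := by
    intro j
    have h2 := (coord n).hasSum
      ((((tri w h (e j)).flip z)).hasSum (hasSum_smul_e y))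
    simp only [map_smul, coord_apply, smul_eq_mul, ContinuousLinearMap.flip_apply,
      tri_e_apply] at h2
    refine h2.unique ?_
    have h3 := hasSum_sum_of_ne_finset_zero (s := Finset.range (n + j + 1))
      (f := fun k => y k * if k ≤ n + j then w j k (n + j - k) * z (n + j - k) else 0)
      (L := SummationFilter.unconditional ℕ) fun k hk => by
        rw [if_neg (by simp at hk; omega), mul_zero]
    convert! h3 using 1
    refine Finset.sum_congr rfl fun k hk => ?_
    rw [if_pos (by simp at hk; omega)]; ring
  have h2 := (coord n).hasSum (((((tri w h).flip y).flip z)).hasSum (hasSum_smul_e x))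
  simp only [map_smul, coord_apply, smul_eq_mul, ContinuousLinearMap.flip_apply, h1] at h2
  convert! h2 using 2 with j
  rw [Finset.mul_sum]
  refine Finset.sum_congr rfl fun k _ => ?_
  ring

end Tri

end Ell1

/-! ### The interaction coefficient and the equation in ℓ¹ -/

theorem interaction_le_first (n j k m : ℕ) : interaction n j k m ≤ n + 1 := by
  unfold interaction; omega

theorem interaction_le_second (n j k m : ℕ) : interaction n j k m ≤ j + 1 := by
  unfold interaction; omega

theorem cast_interaction_le_first (n j k m : ℕ) : (interaction n j k m : ℝ) ≤ n + 1 := by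
  exact_mod_cast interaction_le_first n j k m

theorem cast_interaction_le_second (n j k m : ℕ) : (interaction n j k m : ℝ) ≤ j + 1 := by
  exact_mod_cast interaction_le_second n j k m

namespace Ell1

/-- The interaction coefficient divided by `n + 1`. -/
noncomputable def weightFirst (j k m : ℕ) : ℝ :=
  (interaction (k + m - j) j k m : ℝ) / (((k + m - j : ℕ) : ℝ) + 1)

/-- The interaction coefficient divided by `(n + 1) ^ 2`. -/
noncomputable def weightSq (j k m : ℕ) : ℝ :=
  (interaction (k + m - j) j k m : ℝ) / (((k + m - j : ℕ) : ℝ) + 1) ^ 2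

/-- The interaction coefficient divided by `j + 1`. -/
noncomputable def weightSecond (j k m : ℕ) : ℝ :=
  (interaction (k + m - j) j k m : ℝ) / ((j : ℝ) + 1)

theorem abs_weightFirst_le (j k m : ℕ) : |weightFirst j k m| ≤ 1 := by
  unfold weightFirst
  rw [abs_of_nonneg (by positivity), div_le_one (by positivity)]
  exact cast_interaction_le_first _ _ _ _

theorem abs_weightSecond_le (j k m : ℕ) : |weightSecond j k m| ≤ 1 := by
  unfold weightSecond
  rw [abs_of_nonneg (by positivity), div_le_one (by positivity)]
  exact cast_interaction_le_second _ _ _ _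

theorem abs_weightSq_le (j k m : ℕ) : |weightSq j k m| ≤ 1 := by
  unfold weightSq
  rw [abs_of_nonneg (by positivity), div_le_one (by positivity)]
  have := cast_interaction_le_first (k + m - j) j k m
  nlinarith [Nat.cast_nonneg (α := ℝ) (k + m - j)]

/-- The cubic interaction divided by `(n + 1) ^ 2`, as a trilinear map on `ℓ¹(ℕ)`. -/
noncomputable def T : Ell1 →L[ℝ] Ell1 →L[ℝ] Ell1 →L[ℝ] Ell1 := tri weightSq abs_weightSq_le

theorem norm_T_le (x y z : Ell1) : ‖T x y z‖ ≤ ‖x‖ * ‖y‖ * ‖z‖ := norm_tri_le _ x y z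

theorem T_hasSum (x y z : Ell1) (n : ℕ) :
    HasSum (fun j => ∑ k ∈ Finset.range (n + j + 1),
      (interaction n j k (n + j - k) : ℝ) * x j * y k * z (n + j - k))
      (((n : ℝ) + 1) ^ 2 * T x y z n) := by
  have h := (tri_apply_hasSum abs_weightSq_le x y z n).mul_left (((n : ℝ) + 1) ^ 2)
  convert! h using 2 with j
  rw [Finset.mul_sum]
  refine Finset.sum_congr rfl fun k hk => ?_
  have hn : k + (n + j - k) - j = n := by simp at hk; omega
  have : ((n : ℝ) + 1) ^ 2 ≠ 0 := by positivity
  rw [weightSq, hn]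
  field_simp

theorem cubicTerm_hasSum (x : Ell1) (n : ℕ) :
    HasSum (cubicTerm x n) (((n : ℝ) + 1) ^ 2 * T x x x n) := T_hasSum x x x n

theorem tri_weightFirst_apply (x y z : Ell1) (n : ℕ) :
    tri weightFirst abs_weightFirst_le x y z n = ((n : ℝ) + 1) * T x y z n := by
  have h := (tri_apply_hasSum abs_weightSq_le x y z n).mul_left ((n : ℝ) + 1)
  refine (tri_apply_hasSum abs_weightFirst_le x y z n).unique ?_
  convert! h using 2 with j
  rw [Finset.mul_sum]
  refine Finset.sum_congr rfl fun k hk => ?_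
  have hn : k + (n + j - k) - j = n := by simp at hk; omega
  have : (n : ℝ) + 1 ≠ 0 := by positivity
  rw [weightSq, weightFirst, hn]
  field_simp

/-- Using S ≤ j+1 instead of S ≤ n+1, a weight on the first argument pays for the undivided
nonlinearity. -/
theorem tri_weightSecond_apply {x y : Ell1} (hy : ∀ n : ℕ, y n = ((n : ℝ) + 1) * x n)
    (z t : Ell1) (n : ℕ) :
    tri weightSecond abs_weightSecond_le y z t n = ((n : ℝ) + 1) ^ 2 * T x z t n := by
  refine (tri_apply_hasSum abs_weightSecond_le y z t n).unique ?_
  convert! T_hasSum x z t n using 2 with j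
  refine Finset.sum_congr rfl fun k hk => ?_
  have hn : k + (n + j - k) - j = n := by simp at hk; omega
  have : (j : ℝ) + 1 ≠ 0 := by positivity
  rw [weightSecond, hn, hy]
  field_simp

/-- The stationary equation with `lam = 1 + ω`, divided by `(n + 1) ^ 2`, in `ℓ¹(ℕ)`. -/
def Stationary (ω : ℝ) (x : Ell1) : Prop :=
  ∀ n : ℕ, (1 - ((n : ℝ) - 1) * ω) / ((n : ℝ) + 1) * x n = T x x x n

theorem Stationary.isStationaryState {ω : ℝ} (hω : 0 < ω) {x : Ell1} (h : Stationary ω x) :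
    IsStationaryState (1 + ω) ω (toEll2 x) := by
  have h0 : ∀ n : ℕ, ((n : ℝ) + 1) * (1 + ω - n * ω) * x n = ((n : ℝ) + 1) ^ 2 * T x x x n := by
    intro n
    have : (n : ℝ) + 1 ≠ 0 := by positivity
    rw [← h n]; field_simp; ring
  constructor
  -- The equation reads ω(n+1)x_n = (1+2ω)x_n - (n+1)T(x,x,x)_n, so (n+1)x_n is summable. The weight
  -- thus gained puts the undivided right-hand side in ℓ¹, hence in ℓ².
  · set y : Ell1 := ω⁻¹ • ((1 + 2 * ω) • x - tri weightFirst abs_weightFirst_le x x x) with hy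
    have hy' : ∀ n : ℕ, y n = ((n : ℝ) + 1) * x n := by
      intro n
      have : y n = ω⁻¹ * ((1 + 2 * ω) * x n - tri weightFirst abs_weightFirst_le x x x n) := rfl
      have hn : (n : ℝ) + 1 ≠ 0 := by positivity
      rw [this, tri_weightFirst_apply, ← h n]
      field_simp
      ring
    have hmem := lp.memℓp (toEll2 (tri weightSecond abs_weightSecond_le y x x))
    convert! hmem using 2 with n
    rw [toEll2_apply, toEll2_apply, tri_weightSecond_apply hy', h0]
  · intro n
    rw [toEll2_apply, h0]
    convert! cubicTerm_hasSum x n using 1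
    funext j
    simp [cubicTerm]

theorem stationary_of_isStationaryState {ω : ℝ} {x : Ell1}
    (h : IsStationaryState (1 + ω) ω (toEll2 x)) : Stationary ω x := by
  intro n
  have h1 := h.hasSum n
  have h2 : cubicTerm (toEll2 x) n = cubicTerm x n := by
    funext j
    simp [cubicTerm]
  rw [h2] at h1
  have h3 := h1.unique (cubicTerm_hasSum x n)
  rw [toEll2_apply] at h3
  have : (n : ℝ) + 1 ≠ 0 := by positivity
  have h4 : ((n : ℝ) + 1) * (1 + ω - n * ω) * x n =
      ((n : ℝ) + 1) ^ 2 * ((1 - ((n : ℝ) - 1) * ω) / ((n : ℝ) + 1) * x n) := by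
    field_simp; ring
  rw [h4] at h3
  exact mul_left_cancel₀ (by positivity) h3

end Ell1

/-! ### Solutions in ℓ² are summable -/

theorem IsStationaryState.memℓp_mul {ω : ℝ} (hω : 0 < ω) {A : Ell2}
    (h : IsStationaryState (1 + ω) ω A) : Memℓp (fun n : ℕ => ((n : ℝ) + 1) * A n) 2 := by
  have hA := lp.memℓp A
  have hg : Memℓp (fun n : ℕ => (1 + ω - n * ω) * A n) 2 := by
    refine h.memℓp.mono' fun n => ?_
    have h1 : (1 : ℝ) ≤ (n : ℝ) + 1 := by linarith [Nat.cast_nonneg (α := ℝ) n]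
    simp only [norm_mul, Real.norm_eq_abs]
    rw [abs_of_nonneg (by positivity : (0 : ℝ) ≤ (n : ℝ) + 1)]
    gcongr
    nlinarith [abs_nonneg (1 + ω - n * ω)]
  -- ω(n+1)A_n = (1+2ω)A_n - (1+ω-nω)A_n.
  have := ((hA.const_smul (1 + 2 * ω)).sub hg).const_smul ω⁻¹
  convert! this using 2 with n
  simp
  field_simp
  ring

theorem Memℓp.summable_sq {f : ℕ → ℝ} (h : Memℓp f 2) : Summable fun n => f n ^ 2 := by
  have := h.summable (by norm_num)
  simpa using this

/-- Sequences in `ℓ^{2,1}(ℕ)` are summable. -/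
theorem Ell1.exists_toEll2_eq {A : Ell2} (h : Memℓp (fun n : ℕ => ((n : ℝ) + 1) * A n) 2) :
    ∃ x : Ell1, Ell1.toEll2 x = A := by
  have h1 : Summable fun n : ℕ => 1 / ((n : ℝ) + 1) ^ 2 := by
    have := (summable_nat_add_iff 1).2 (Real.summable_one_div_nat_pow.2 one_lt_two)
    simpa using this
  have hs : Summable fun n => |A n| := by
    refine Summable.of_nonneg_of_le (fun n => abs_nonneg _) (fun n => ?_)
      (h1.add h.summable_sq)
    have hn : (n : ℝ) + 1 ≠ 0 := by positivity
    have h2 : 2 * (1 / ((n : ℝ) + 1)) * (((n : ℝ) + 1) * |A n|) = 2 * |A n| := by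
      field_simp
    have h3 := two_mul_le_add_sq (1 / ((n : ℝ) + 1)) (((n : ℝ) + 1) * |A n|)
    rw [h2, mul_pow _ |A n|, sq_abs, one_div_pow] at h3
    rw [mul_pow]
    linarith [abs_nonneg (A n)]
  have hmem : Memℓp (A : ℕ → ℝ) 1 := by
    refine memℓp_gen ?_
    simpa using hs
  refine ⟨⟨A, hmem⟩, ?_⟩
  ext n
  rw [Ell1.toEll2_apply]

/-! ### Boundedness of the interaction on the energy space -/

theorem interaction_pair_comm (n j k m : ℕ) : interaction n j k m = interaction k m n j := by
  unfold interaction; omega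

/-- Raising k to k+1 adds 1 exactly at the s-2k-1 indices with k+1 ≤ i ≤ s-(k+1). -/
theorem sum_range_min_min (s k : ℕ) (hk : 2 * k ≤ s) :
    ∑ i ∈ Finset.range (s + 1), (min (min i (s - i)) k + 1) = (k + 1) * (s - k + 1) := by
  induction k with
  | zero => simp
  | succ k ih =>
    have h1 : ∀ i ∈ Finset.range (s + 1), min (min i (s - i)) (k + 1) + 1
        = (min (min i (s - i)) k + 1) + if i ∈ Finset.Icc (k + 1) (s - (k + 1)) then 1 else 0 := by
      intro i hi
      simp only [Finset.mem_range] at hi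
      by_cases h : i ∈ Finset.Icc (k + 1) (s - (k + 1))
      · rw [if_pos h]; rw [Finset.mem_Icc] at h; omega
      · rw [if_neg h]; rw [Finset.mem_Icc] at h; omega
    rw [Finset.sum_congr rfl h1, Finset.sum_add_distrib, ih (by omega), Finset.sum_ite_mem,
      Finset.inter_eq_right.2, Finset.sum_const, Nat.card_Icc]
    · obtain ⟨t, rfl⟩ := Nat.exists_eq_add_of_le hk
      have e1 : 2 * (k + 1) + t - k = k + 2 + t := by omega
      have e2 : 2 * (k + 1) + t - (k + 1) = k + 1 + t := by omega
      rw [e1, e2]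
      have e3 : k + 1 + t + 1 - (k + 1) = t + 1 := by omega
      rw [e3]
      simp only [smul_eq_mul]
      ring
    · intro i hi
      simp only [Finset.mem_Icc, Finset.mem_range] at *
      omega

/-- Summing S over all pairs resonant with a fixed pair gives exactly the product of the weights of
ℓ^{2,1/2}; this is why the Cauchy–Schwarz estimate closes in that space. -/
theorem sum_antidiagonal_interaction (k m : ℕ) :
    ∑ p ∈ Finset.HasAntidiagonal.antidiagonal (k + m), interaction p.1 p.2 k m = (k + 1) * (m + 1) := by
  rw [Finset.Nat.sum_antidiagonal_eq_sum_range_succ (fun a b => interaction a b k m)]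
  rcases le_total k m with h | h
  · have := sum_range_min_min (k + m) k (by omega)
    rw [Nat.add_sub_cancel_left] at this
    rw [← this]
    exact Finset.sum_congr rfl fun i _ => by simp [interaction, h]
  · have := sum_range_min_min (k + m) m (by omega)
    rw [Nat.add_sub_cancel, mul_comm] at this
    rw [← this]
    exact Finset.sum_congr rfl fun i _ => by simp [interaction, h]

theorem sum_antidiagonal_interaction' (n j : ℕ) :
    ∑ q ∈ Finset.HasAntidiagonal.antidiagonal (n + j), (interaction n j q.1 q.2 : ℝ)
      = ((n : ℝ) + 1) * ((j : ℝ) + 1) := by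
  have := sum_antidiagonal_interaction n j
  have h2 : ∑ q ∈ Finset.HasAntidiagonal.antidiagonal (n + j), interaction n j q.1 q.2 = (n + 1) * (j + 1) := by
    rw [← this]
    exact Finset.sum_congr rfl fun q _ => interaction_pair_comm _ _ _ _
  exact_mod_cast h2

/-- A sum over a rectangle is at most the sum over the antidiagonals meeting it. -/
theorem sum_rectangle_le_sum_antidiagonal {φ : ℕ × ℕ → ℝ} (hφ : ∀ p, 0 ≤ φ p) (N J : ℕ) :
    ∑ p ∈ Finset.range N ×ˢ Finset.range J, φ p
      ≤ ∑ s ∈ Finset.range (N + J), ∑ p ∈ Finset.HasAntidiagonal.antidiagonal s, φ p := by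
  rw [← Finset.sum_fiberwise_of_maps_to (t := Finset.range (N + J)) (g := fun p => p.1 + p.2)]
  · refine Finset.sum_le_sum fun s _ => ?_
    refine Finset.sum_le_sum_of_subset_of_nonneg (fun p hp => ?_) fun p _ _ => hφ p
    simp at hp ⊢
    exact hp.2
  · intro p hp
    simp at hp ⊢
    omega

theorem sum_antidiagonal_le_sum_square {φ : ℕ × ℕ → ℝ} (hφ : ∀ p, 0 ≤ φ p) (N : ℕ) :
    ∑ s ∈ Finset.range N, ∑ p ∈ Finset.HasAntidiagonal.antidiagonal s, φ p
      ≤ ∑ p ∈ Finset.range N ×ˢ Finset.range N, φ p := by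
  rw [← Finset.sum_biUnion]
  · refine Finset.sum_le_sum_of_subset_of_nonneg (fun p hp => ?_) fun p _ _ => hφ p
    simp at hp ⊢
    omega
  · intro s _ t _ hst
    rw [Function.onFun, Finset.disjoint_left]
    intro p hp hp'
    simp at hp hp'
    omega

/-- Cauchy–Schwarz over resonant quadruples, with S split as √S·√S: one factor carries u_n x_j, the
other y_k z_m. In each squared factor, the sum of S over the free pair factorizes. -/
theorem resonant_sum_sq_le (u x y z : ℕ → ℝ) (N J : ℕ) :
    (∑ n ∈ Finset.range N, ∑ j ∈ Finset.range J, ∑ k ∈ Finset.range (n + j + 1),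
      u n * ((interaction n j k (n + j - k) : ℝ) * x j * y k * z (n + j - k))) ^ 2
    ≤ ((∑ n ∈ Finset.range N, ((n : ℝ) + 1) * u n ^ 2)
        * ∑ n ∈ Finset.range J, ((n : ℝ) + 1) * x n ^ 2)
      * ((∑ n ∈ Finset.range (N + J), ((n : ℝ) + 1) * y n ^ 2)
        * ∑ n ∈ Finset.range (N + J), ((n : ℝ) + 1) * z n ^ 2) := by
  set D := (Finset.range N ×ˢ Finset.range J).sigma
    fun p => Finset.HasAntidiagonal.antidiagonal (p.1 + p.2) with hD
  let f : (_ : ℕ × ℕ) × (ℕ × ℕ) → ℝ := fun r =>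
    √(interaction r.1.1 r.1.2 r.2.1 r.2.2 : ℝ) * (u r.1.1 * x r.1.2)
  let g : (_ : ℕ × ℕ) × (ℕ × ℕ) → ℝ := fun r =>
    √(interaction r.1.1 r.1.2 r.2.1 r.2.2 : ℝ) * (y r.2.1 * z r.2.2)
  have h0 : (∑ n ∈ Finset.range N, ∑ j ∈ Finset.range J, ∑ k ∈ Finset.range (n + j + 1),
      u n * ((interaction n j k (n + j - k) : ℝ) * x j * y k * z (n + j - k)))
      = ∑ r ∈ D, f r * g r := by
    rw [hD, Finset.sum_sigma, Finset.sum_product]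
    refine Finset.sum_congr rfl fun n _ => Finset.sum_congr rfl fun j _ => ?_
    rw [Finset.Nat.sum_antidiagonal_eq_sum_range_succ
      (fun a b => f ⟨(n, j), (a, b)⟩ * g ⟨(n, j), (a, b)⟩)]
    refine Finset.sum_congr rfl fun k _ => ?_
    have := Real.mul_self_sqrt (Nat.cast_nonneg (α := ℝ) (interaction n j k (n + j - k)))
    simp only [f, g]
    linear_combination (-(u n * x j * y k * z (n + j - k))) * this
  have hf : ∑ r ∈ D, f r ^ 2 = (∑ n ∈ Finset.range N, ((n : ℝ) + 1) * u n ^ 2)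
        * ∑ n ∈ Finset.range J, ((n : ℝ) + 1) * x n ^ 2 := by
    rw [hD, Finset.sum_sigma, Finset.sum_product, Finset.sum_mul_sum]
    refine Finset.sum_congr rfl fun n _ => Finset.sum_congr rfl fun j _ => ?_
    simp only [f, mul_pow, Real.sq_sqrt (Nat.cast_nonneg _)]
    rw [← Finset.sum_mul, sum_antidiagonal_interaction']
    ring
  have hg : ∑ r ∈ D, g r ^ 2 ≤ (∑ n ∈ Finset.range (N + J), ((n : ℝ) + 1) * y n ^ 2)
        * ∑ n ∈ Finset.range (N + J), ((n : ℝ) + 1) * z n ^ 2 := by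
    rw [hD, Finset.sum_sigma]
    simp only [g, mul_pow, Real.sq_sqrt (Nat.cast_nonneg _)]
    -- The free pair is now (n,j), confined to a rectangle; enlarging it to whole antidiagonals
    -- makes the summation identity applicable.
    refine (sum_rectangle_le_sum_antidiagonal (fun p => Finset.sum_nonneg fun q _ => by
      positivity) N J).trans ?_
    have h1 : ∀ s ∈ Finset.range (N + J), (∑ p ∈ Finset.HasAntidiagonal.antidiagonal s,
        ∑ q ∈ Finset.HasAntidiagonal.antidiagonal (p.1 + p.2),
          (interaction p.1 p.2 q.1 q.2 : ℝ) * (y q.1 ^ 2 * z q.2 ^ 2))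
        = ∑ q ∈ Finset.HasAntidiagonal.antidiagonal s,
          (((q.1 : ℝ) + 1) * y q.1 ^ 2) * (((q.2 : ℝ) + 1) * z q.2 ^ 2) := by
      intro s _
      have h2 : ∀ p ∈ Finset.HasAntidiagonal.antidiagonal s, ∑ q ∈ Finset.HasAntidiagonal.antidiagonal (p.1 + p.2),
          (interaction p.1 p.2 q.1 q.2 : ℝ) * (y q.1 ^ 2 * z q.2 ^ 2)
          = ∑ q ∈ Finset.HasAntidiagonal.antidiagonal s,
          (interaction p.1 p.2 q.1 q.2 : ℝ) * (y q.1 ^ 2 * z q.2 ^ 2) := by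
        intro p hp
        rw [Finset.HasAntidiagonal.mem_antidiagonal.1 hp]
      rw [Finset.sum_congr rfl h2, Finset.sum_comm]
      refine Finset.sum_congr rfl fun q hq => ?_
      rw [← Finset.sum_mul, ← Finset.HasAntidiagonal.mem_antidiagonal.1 hq]
      have := sum_antidiagonal_interaction q.1 q.2
      have h3 : (∑ p ∈ Finset.HasAntidiagonal.antidiagonal (q.1 + q.2), (interaction p.1 p.2 q.1 q.2 : ℝ))
        = ((q.1 : ℝ) + 1) * ((q.2 : ℝ) + 1) := by exact_mod_cast this
      rw [h3]; ring
    rw [Finset.sum_congr rfl h1]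
    refine (sum_antidiagonal_le_sum_square (φ := fun q =>
      (((q.1 : ℝ) + 1) * y q.1 ^ 2) * (((q.2 : ℝ) + 1) * z q.2 ^ 2))
      (fun q => by positivity) _).trans ?_
    rw [Finset.sum_product, Finset.sum_mul_sum]
  rw [h0]
  refine (Finset.sum_mul_sq_le_sq_mul_sq D f g).trans ?_
  rw [hf]
  exact mul_le_mul_of_nonneg_left hg (by positivity)

namespace Ell1

/-- The cubic interaction is bounded on the energy space `ℓ^{2,1/2}(ℕ)` by duality. -/
theorem abs_sum_mul_T_le (u : ℕ → ℝ) (x y z : Ell1) {a b c d : ℝ}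
    (ha : 0 ≤ a) (hb : 0 ≤ b) (hc : 0 ≤ c) (hd : 0 ≤ d)
    (hu : ∀ N, ∑ n ∈ Finset.range N, ((n : ℝ) + 1) * u n ^ 2 ≤ a ^ 2)
    (hx : ∀ N, ∑ n ∈ Finset.range N, ((n : ℝ) + 1) * x n ^ 2 ≤ b ^ 2)
    (hy : ∀ N, ∑ n ∈ Finset.range N, ((n : ℝ) + 1) * y n ^ 2 ≤ c ^ 2)
    (hz : ∀ N, ∑ n ∈ Finset.range N, ((n : ℝ) + 1) * z n ^ 2 ≤ d ^ 2) (N : ℕ) :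
    |∑ n ∈ Finset.range N, u n * (((n : ℝ) + 1) ^ 2 * T x y z n)| ≤ a * b * c * d := by
  have hlim : Tendsto (fun J => |∑ n ∈ Finset.range N, ∑ j ∈ Finset.range J,
      ∑ k ∈ Finset.range (n + j + 1),
      u n * ((interaction n j k (n + j - k) : ℝ) * x j * y k * z (n + j - k))|) atTop
      (𝓝 |∑ n ∈ Finset.range N, u n * (((n : ℝ) + 1) ^ 2 * T x y z n)|) := by
    refine Tendsto.abs (tendsto_finsetSum _ fun n _ => ?_)
    have := ((T_hasSum x y z n).mul_left (u n)).tendsto_sum_nat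
    simpa only [Finset.mul_sum] using this
  refine le_of_tendsto hlim (Eventually.of_forall fun J => ?_)
  refine abs_le_of_sq_le_sq ?_ (by positivity)
  refine (resonant_sum_sq_le u x y z N J).trans ?_
  have : (a * b * c * d) ^ 2 = (a ^ 2 * b ^ 2) * (c ^ 2 * d ^ 2) := by ring
  rw [this]
  gcongr
  · exact hu _
  · exact hx _
  · exact hy _
  · exact hz _

theorem T_e (j k m : ℕ) : T (e j) (e k) (e m) =
    if j ≤ k + m then
      ((interaction (k + m - j) j k m : ℝ) / (((k + m - j : ℕ) : ℝ) + 1) ^ 2) • e (k + m - j)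
    else 0 := by
  rw [T, tri_e]; rfl

@[simp] theorem add_apply (x y : Ell1) (n : ℕ) : (x + y) n = x n + y n := rfl
@[simp] theorem sub_apply (x y : Ell1) (n : ℕ) : (x - y) n = x n - y n := rfl
@[simp] theorem smul_apply (c : ℝ) (x : Ell1) (n : ℕ) : (c • x) n = c * x n := rfl
@[simp] theorem neg_apply (x : Ell1) (n : ℕ) : (-x) n = - x n := rfl
@[simp] theorem zero_apply (n : ℕ) : (0 : Ell1) n = 0 := rfl

theorem T_e_one : T (e 1) (e 1) (e 1) = (1 / 2 : ℝ) • e 1 := by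
  rw [T_e]; norm_num [interaction]

theorem stationary_e_one (ω : ℝ) : Stationary ω (e 1) := by
  intro n
  rw [T_e_one, smul_apply]
  by_cases h : n = 1
  · subst h; norm_num
  · simp [e_apply_ne h]

/-! ### From closeness in ℓ² to closeness in ℓ¹ -/

theorem sum_e_one_le (N : ℕ) :
    ∑ n ∈ Finset.range N, ((n : ℝ) + 1) * e 1 n ^ 2 ≤ (3 / 2) ^ 2 := by
  have : ∀ n ∈ Finset.range N, ((n : ℝ) + 1) * e 1 n ^ 2 = if n = 1 then 2 else 0 := by
    intro n _
    by_cases h : n = 1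
    · subst h; norm_num
    · simp [e_apply_ne h, h]
  rw [Finset.sum_congr rfl this, Finset.sum_ite_eq']
  split_ifs <;> norm_num

theorem Stationary.sub_e_one {ω : ℝ} {x : Ell1} (h : Stationary ω x) (n : ℕ) :
    ((1 + 2 * ω) * ((n : ℝ) + 1) - ω * ((n : ℝ) + 1) ^ 2) * (x - e 1) n
      = ((n : ℝ) + 1) ^ 2 * (T x x x - T (e 1) (e 1) (e 1)) n := by
  have hn : (n : ℝ) + 1 ≠ 0 := by positivity
  rw [sub_apply, sub_apply, ← h n, ← stationary_e_one ω n]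
  field_simp
  ring

/-- Multiply the equation for a = x - e_1 by a_n and sum. With 3/2 bounding the energy norm √2 of
e_1, the three terms linear in a cost 27/4 q², the three quadratic ones 9/2 q³ ≤ 9/4 (q² + q⁴), and
the cubic one q⁴. -/
theorem Stationary.energy_le {ω : ℝ} (hω : 0 ≤ ω) {x : Ell1} (h : Stationary ω x) {q : ℝ}
    (hq : 0 ≤ q)
    (hx : ∀ N, ∑ n ∈ Finset.range N, ((n : ℝ) + 1) * (x - e 1) n ^ 2 ≤ q ^ 2) (N : ℕ) :
    ω * ∑ n ∈ Finset.range N, (((n : ℝ) + 1) * (x - e 1) n) ^ 2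
      ≤ (11 + 2 * ω) * q ^ 2 + 4 * q ^ 4 := by
  set a := x - e 1 with ha
  have hxa : x = e 1 + a := by rw [ha]; abel
  have h1 : ω * ∑ n ∈ Finset.range N, (((n : ℝ) + 1) * a n) ^ 2
      = (1 + 2 * ω) * ∑ n ∈ Finset.range N, ((n : ℝ) + 1) * a n ^ 2
        - ∑ n ∈ Finset.range N, a n * (((n : ℝ) + 1) ^ 2 *
          (T x x x - T (e 1) (e 1) (e 1)) n) := by
    rw [Finset.mul_sum, Finset.mul_sum, ← Finset.sum_sub_distrib]
    refine Finset.sum_congr rfl fun n _ => ?_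
    rw [← h.sub_e_one n]
    ring
  have h2 : T x x x - T (e 1) (e 1) (e 1) = T a (e 1) (e 1) + T (e 1) a (e 1) + T (e 1) (e 1) a
      + T a a (e 1) + T a (e 1) a + T (e 1) a a + T a a a := by
    rw [hxa]
    simp only [map_add, _root_.add_apply]
    abel
  have b0 : (0 : ℝ) ≤ 3 / 2 := by norm_num
  have t1 := abs_le.1 (abs_sum_mul_T_le a a (e 1) (e 1) hq hq b0 b0 hx hx sum_e_one_le
    sum_e_one_le N)
  have t2 := abs_le.1 (abs_sum_mul_T_le a (e 1) a (e 1) hq b0 hq b0 hx sum_e_one_le hx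
    sum_e_one_le N)
  have t3 := abs_le.1 (abs_sum_mul_T_le a (e 1) (e 1) a hq b0 b0 hq hx sum_e_one_le
    sum_e_one_le hx N)
  have t4 := abs_le.1 (abs_sum_mul_T_le a a a (e 1) hq hq hq b0 hx hx hx sum_e_one_le N)
  have t5 := abs_le.1 (abs_sum_mul_T_le a a (e 1) a hq hq b0 hq hx hx sum_e_one_le hx N)
  have t6 := abs_le.1 (abs_sum_mul_T_le a (e 1) a a hq b0 hq hq hx sum_e_one_le hx hx N)
  have t7 := abs_le.1 (abs_sum_mul_T_le a a a a hq hq hq hq hx hx hx hx N)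
  rw [h1, h2]
  simp only [add_apply, mul_add, Finset.sum_add_distrib]
  have h3 := mul_le_mul_of_nonneg_left (hx N) (by linarith : 0 ≤ 1 + 2 * ω)
  have h4 : q ^ 3 * 2 ≤ q ^ 2 + q ^ 4 := by nlinarith [sq_nonneg (q - q ^ 2)]
  nlinarith [t1.1, t2.1, t3.1, t4.1, t5.1, t6.1, t7.1, sq_nonneg q, sq_nonneg (q ^ 2)]

/-- Weighted AM–GM: |a_n| ≤ τ/(n+1)² + τ⁻¹((n+1)a_n)². -/
theorem norm_le_of_weighted {a : Ell1} {τ : ℝ} (hτ : 0 < τ)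
    (hs : Summable fun n : ℕ => (((n : ℝ) + 1) * a n) ^ 2)
    (h : ∑' n : ℕ, (((n : ℝ) + 1) * a n) ^ 2 ≤ τ ^ 2) :
    ‖a‖ ≤ ((∑' n : ℕ, 1 / ((n : ℝ) + 1) ^ 2) + 1) * τ := by
  have h1 : Summable fun n : ℕ => 1 / ((n : ℝ) + 1) ^ 2 := by
    have := (summable_nat_add_iff 1).2 (Real.summable_one_div_nat_pow.2 one_lt_two)
    simpa using this
  have hle : ∀ n : ℕ, |a n| ≤ τ * (1 / ((n : ℝ) + 1) ^ 2) + τ⁻¹ * (((n : ℝ) + 1) * a n) ^ 2 := by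
    intro n
    have hn : (n : ℝ) + 1 ≠ 0 := by positivity
    have h2 := two_mul_le_add_sq (τ * (1 / ((n : ℝ) + 1))) (((n : ℝ) + 1) * |a n|)
    have h3 : 2 * (τ * (1 / ((n : ℝ) + 1))) * (((n : ℝ) + 1) * |a n|) = 2 * τ * |a n| := by
      field_simp
    rw [h3, mul_pow _ |a n|, sq_abs, mul_pow, one_div_pow] at h2
    have h4 : τ * |a n| ≤ τ ^ 2 * (1 / ((n : ℝ) + 1) ^ 2) + ((n : ℝ) + 1) ^ 2 * a n ^ 2 := by
      nlinarith [abs_nonneg (a n)]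
    rw [← mul_le_mul_iff_right₀ hτ]
    calc τ * |a n| ≤ _ := h4
      _ = _ := by field_simp
  have h5 := (hasSum_abs a).tsum_eq ▸ Summable.tsum_le_tsum hle (hasSum_abs a).summable
    ((h1.mul_left τ).add (hs.mul_left τ⁻¹))
  rw [(h1.mul_left τ).tsum_add (hs.mul_left τ⁻¹), tsum_mul_left, tsum_mul_left] at h5
  have h6 : τ⁻¹ * ∑' n : ℕ, (((n : ℝ) + 1) * a n) ^ 2 ≤ τ := by
    calc _ ≤ τ⁻¹ * τ ^ 2 := by gcongr
      _ = τ := by field_simp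
  linarith

theorem exists_near_of_isStationaryState {ρ : ℝ} (hρ : 0 < ρ) : ∃ δ > 0, ∀ (ω : ℝ) (A : Ell2),
    |ω - 1 / 15| < δ → ‖A - secondMode‖ < δ → IsStationaryState (1 + ω) ω A →
    ∃ x : Ell1, toEll2 x = A ∧ Stationary ω x ∧ ‖x - e 1‖ < ρ := by
  set K := (∑' n : ℕ, 1 / ((n : ℝ) + 1) ^ 2) + 1 with hK
  have hK0 : 0 < K := by
    have : 0 ≤ ∑' n : ℕ, 1 / ((n : ℝ) + 1) ^ 2 := tsum_nonneg fun n => by positivity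
    linarith
  refine ⟨min (1 / 30) (ρ / (2000 * K)), by positivity, fun ω A hω hA hst => ?_⟩
  set δ := min (1 / 30) (ρ / (2000 * K)) with hδ
  have hδ1 : δ ≤ 1 / 30 := min_le_left _ _
  have hδ2 : δ ≤ ρ / (2000 * K) := min_le_right _ _
  have hω1 : 1 / 30 < ω := by linarith [(abs_lt.1 hω).1]
  have hω2 : ω < 1 / 10 := by linarith [(abs_lt.1 hω).2]
  have hmem := hst.memℓp_mul (by linarith)
  obtain ⟨x, rfl⟩ := exists_toEll2_eq hmem
  have hx := stationary_of_isStationaryState hst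
  refine ⟨x, rfl, hx, ?_⟩
  set a := x - e 1 with ha
  rw [← toEll2_e_one, ← map_sub, ← ha] at hA
  have hδ0 : 0 < δ := (norm_nonneg _).trans_lt hA
  have hs2 : Summable fun n : ℕ => (((n : ℝ) + 1) * a n) ^ 2 := by
    have h1 : Memℓp (fun n : ℕ => ((n : ℝ) + 1) * e 1 n) 2 := by
      have h2 := (lp.memℓp (toEll2 (e 1))).const_smul (2 : ℝ)
      convert! h2 using 2 with n
      simp only [Pi.smul_apply, smul_eq_mul, toEll2_apply]
      by_cases h : n = 1
      · subst h; norm_num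
      · simp [e_apply_ne h]
    have h3 := (hmem.sub h1).summable_sq
    convert! h3 using 3 with n
    simp only [Pi.sub_apply, toEll2_apply, ha, sub_apply]
    ring
  have hs0 : Summable fun n : ℕ => a n ^ 2 := by
    have := (lp.memℓp (toEll2 a)).summable_sq
    simpa using this
  have hd : ∑' n : ℕ, a n ^ 2 ≤ δ ^ 2 := by
    have h1 := lp.norm_rpow_eq_tsum (p := 2) (by norm_num) (toEll2 a)
    simp at h1
    rw [← h1]
    gcongr
  set H := √(∑' n : ℕ, (((n : ℝ) + 1) * a n) ^ 2) with hH
  have hHsq : H ^ 2 = ∑' n : ℕ, (((n : ℝ) + 1) * a n) ^ 2 :=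
    Real.sq_sqrt (tsum_nonneg fun n => sq_nonneg _)
  have hH0 : 0 ≤ H := Real.sqrt_nonneg _
  -- Interpolation: the squared energy norm is at most ‖a‖_{ℓ²} times H, the ℓ² norm of (n+1)a_n.
  have hq : ∀ N, ∑ n ∈ Finset.range N, ((n : ℝ) + 1) * a n ^ 2 ≤ √(δ * H) ^ 2 := by
    intro N
    rw [Real.sq_sqrt (by positivity)]
    have h1 := Finset.sum_mul_sq_le_sq_mul_sq (Finset.range N) (fun n => a n)
      (fun n => ((n : ℝ) + 1) * a n)
    have h2 : ∑ n ∈ Finset.range N, a n ^ 2 ≤ δ ^ 2 :=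
      (hs0.sum_le_tsum _ fun n _ => sq_nonneg _).trans hd
    have h3 : ∑ n ∈ Finset.range N, (((n : ℝ) + 1) * a n) ^ 2 ≤ H ^ 2 := by
      rw [hHsq]
      exact hs2.sum_le_tsum _ fun n _ => sq_nonneg _
    have h4 : ∑ n ∈ Finset.range N, ((n : ℝ) + 1) * a n ^ 2
        = ∑ n ∈ Finset.range N, a n * (((n : ℝ) + 1) * a n) :=
      Finset.sum_congr rfl fun n _ => by ring
    rw [h4]
    refine abs_le_of_sq_le_sq' ?_ (by positivity) |>.2
    refine h1.trans ?_
    rw [mul_pow]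
    exact mul_le_mul h2 h3 (Finset.sum_nonneg fun n _ => sq_nonneg _) (sq_nonneg _)
  have hE := hx.energy_le (by linarith) (Real.sqrt_nonneg _) hq
  have h4 : √(δ * H) ^ 4 = (δ * H) ^ 2 := by
    have : √(δ * H) ^ 4 = (√(δ * H) ^ 2) ^ 2 := by ring
    rw [this, Real.sq_sqrt (by positivity)]
  rw [Real.sq_sqrt (by positivity), h4] at hE
  have hE2 : ω * H ^ 2 ≤ (11 + 2 * ω) * (δ * H) + 4 * (δ * H) ^ 2 := by
    rw [hHsq, ← tsum_mul_left]
    refine (hs2.mul_left ω).tsum_le_of_sum_range_le fun N => ?_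
    rw [← Finset.mul_sum]
    exact hE N
  -- The energy estimate has become ωH ≤ (11+2ω)δ + 4δ²H. As 1/30 < ω < 1/10 and 4δ² ≤ 1/60, the
  -- last term is absorbed, leaving H/60 ≤ 11.2 δ.
  have hHle : H ≤ 720 * δ := by
    by_contra hcon
    push Not at hcon
    have hHp : 0 < H := by nlinarith
    have h5 : ω * H ≤ (11 + 2 * ω) * δ + 4 * δ ^ 2 * H := by
      have : H * (ω * H) ≤ H * ((11 + 2 * ω) * δ + 4 * δ ^ 2 * H) := by linarith
      exact le_of_mul_le_mul_left this hHp
    have h6 : 4 * δ ^ 2 * H ≤ 1 / 60 * H := by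
      have : 4 * δ ^ 2 ≤ 1 / 60 := by nlinarith
      exact mul_le_mul_of_nonneg_right this hH0
    nlinarith
  have hfin := norm_le_of_weighted (a := a) (τ := 720 * δ) (by positivity) hs2 (by
    rw [← hHsq]; gcongr)
  refine hfin.trans_lt ?_
  rw [← hK]
  have h7 : δ * (2000 * K) ≤ ρ := (le_div_iff₀ (by positivity)).1 hδ2
  nlinarith

/-! ### The linearization and its partial inverse -/

theorem abs_ratio_le (n : ℕ) : |((n : ℝ) - 1) / ((n : ℝ) + 1)| ≤ 1 := by
  rw [abs_div, abs_of_nonneg (by positivity : (0 : ℝ) ≤ (n : ℝ) + 1), div_le_one (by positivity),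
    abs_le]
  constructor <;> linarith [Nat.cast_nonneg (α := ℝ) n]

/-- The `ω`-derivative of the linear part, up to sign. -/
noncomputable def M : Ell1 →L[ℝ] Ell1 := diag (fun n => ((n : ℝ) - 1) / ((n : ℝ) + 1)) abs_ratio_le

@[simp] theorem M_apply (x : Ell1) (n : ℕ) : M x n = ((n : ℝ) - 1) / ((n : ℝ) + 1) * x n :=
  diag_apply _ _ _ _

@[simp] theorem M_e (n : ℕ) : M (e n) = (((n : ℝ) - 1) / ((n : ℝ) + 1)) • e n := diag_e _ _ _

theorem norm_M_le (x : Ell1) : ‖M x‖ ≤ ‖x‖ := by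
  have := M.le_of_opNorm_le (norm_diag_le _ abs_ratio_le) x
  simpa using this

theorem abs_linearDiag_le (n : ℕ) :
    |(1 - ((n : ℝ) - 1) * (1 / 15)) / ((n : ℝ) + 1)| ≤ 2 := by
  rw [abs_div, abs_of_nonneg (by positivity : (0 : ℝ) ≤ (n : ℝ) + 1), div_le_iff₀ (by positivity),
    abs_le]
  constructor <;> linarith [Nat.cast_nonneg (α := ℝ) n]

/-- The linearization at the second eigenmode for `ω = 1 / 15`. -/
noncomputable def L : Ell1 →L[ℝ] Ell1 :=
  diag (fun n => (1 - ((n : ℝ) - 1) * (1 / 15)) / ((n : ℝ) + 1)) abs_linearDiag_le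
    - T (e 1) (e 1) - (T (e 1)).flip (e 1) - (T.flip (e 1)).flip (e 1)

theorem L_apply (x : Ell1) : L x =
    diag (fun n => (1 - ((n : ℝ) - 1) * (1 / 15)) / ((n : ℝ) + 1)) abs_linearDiag_le x
    - T (e 1) (e 1) x - T (e 1) x (e 1) - T x (e 1) (e 1) := rfl

theorem L_e_zero : L (e 0) = (-14 / 15 : ℝ) • e 0 + (-1 / 9 : ℝ) • e 2 := by
  rw [L_apply, diag_e, T_e, T_e, T_e]
  norm_num [interaction]
  module

theorem L_e_one : L (e 1) = (-1 : ℝ) • e 1 := by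
  rw [L_apply, diag_e, T_e]
  norm_num [interaction]
  module

theorem L_e_two : L (e 2) = (-1 : ℝ) • e 0 + (-2 / 15 : ℝ) • e 2 := by
  rw [L_apply, diag_e, T_e, T_e, T_e]
  norm_num [interaction]
  module

/-- The term with e_n in the first slot would land in the negative mode 2-n and vanishes. The rest
is (16-n)(n+1) - 60 = -(n-4)(n-11) over 15(n+1)². -/
theorem L_e_of_three_le {n : ℕ} (hn : 3 ≤ n) :
    L (e n) = (-(((n : ℝ) - 4) * ((n : ℝ) - 11)) / (15 * ((n : ℝ) + 1) ^ 2)) • e n := by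
  have h1 : T (e 1) (e 1) (e n) = (2 / ((n : ℝ) + 1) ^ 2) • e n := by
    rw [T_e, if_pos (by omega)]
    have h2 : 1 + n - 1 = n := by omega
    have h3 : interaction n 1 1 n = 2 := by unfold interaction; omega
    rw [h2, h3]; norm_num
  have h2 : T (e 1) (e n) (e 1) = (2 / ((n : ℝ) + 1) ^ 2) • e n := by
    rw [T_e, if_pos (by omega)]
    have h2 : n + 1 - 1 = n := by omega
    have h3 : interaction n 1 n 1 = 2 := by unfold interaction; omega
    rw [h2, h3]; norm_num
  have h3 : T (e n) (e 1) (e 1) = 0 := by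
    rw [T_e, if_neg (by omega)]
  rw [L_apply, diag_e, h1, h2, h3, sub_zero, ← sub_smul, ← sub_smul]
  congr 1
  have : (n : ℝ) + 1 ≠ 0 := by positivity
  field_simp
  ring

/-- The images of the unit vectors under the partial inverse of the linearization. -/
noncomputable def invVal (n : ℕ) : Ell1 :=
  if n = 0 then (-10 : ℝ) • e 0 + (25 / 3 : ℝ) • e 2
  else if n = 1 then (-1 : ℝ) • e 1
  else if n = 2 then (75 : ℝ) • e 0 + (-70 : ℝ) • e 2
  else if n = 4 ∨ n = 11 then 0
  else (-(15 * ((n : ℝ) + 1) ^ 2) / (((n : ℝ) - 4) * ((n : ℝ) - 11))) • e n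

theorem invVal_of_three_le {n : ℕ} (h3 : 3 ≤ n) (h4 : n ≠ 4) (h11 : n ≠ 11) :
    invVal n = (-(15 * ((n : ℝ) + 1) ^ 2) / (((n : ℝ) - 4) * ((n : ℝ) - 11))) • e n := by
  unfold invVal
  rw [if_neg (by omega), if_neg (by omega), if_neg (by omega), if_neg (by omega)]

theorem symbol_ne_zero {n : ℕ} (h4 : n ≠ 4) (h11 : n ≠ 11) :
    ((n : ℝ) - 4) * ((n : ℝ) - 11) ≠ 0 := by
  refine mul_ne_zero (sub_ne_zero.2 ?_) (sub_ne_zero.2 ?_) <;> exact_mod_cast ‹_›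

theorem norm_invVal_le (n : ℕ) : ‖invVal n‖ ≤ 400 := by
  by_cases h3 : 3 ≤ n
  · by_cases h : n = 4 ∨ n = 11
    · have : invVal n = 0 := by rcases h with rfl | rfl <;> simp [invVal]
      rw [this]; norm_num
    · push Not at h
      rw [invVal_of_three_le h3 h.1 h.2]
      refine smul_e_norm_le ?_ n
      rw [abs_div, div_le_iff₀ (abs_pos.2 (symbol_ne_zero h.1 h.2)), abs_neg,
        abs_of_nonneg (by positivity)]
      -- The largest case is n = 12, with 15·169/8 < 317.
      by_cases h12 : 12 ≤ n
      · have h12' : (12 : ℝ) ≤ n := by exact_mod_cast h12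
        rw [abs_of_nonneg (by nlinarith)]
        nlinarith
      · interval_cases n <;> first | omega | norm_num
  · have hs : ∀ a b : ℝ, ‖a • e 0 + b • e 2‖ ≤ |a| + |b| := fun a b => by
      refine (norm_add_le _ _).trans ?_
      simp [norm_smul]
    interval_cases n
    · refine (hs _ _).trans ?_; norm_num [abs_of_pos]
    · simp [invVal]
    · refine (hs _ _).trans ?_; norm_num [abs_of_pos]

/-- The partial inverse of the linearization, vanishing on its kernel. -/
noncomputable def G : Ell1 →L[ℝ] Ell1 := lift invVal norm_invVal_le

@[simp] theorem G_e (n : ℕ) : G (e n) = invVal n := lift_e _ _ _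

theorem norm_G_le (x : Ell1) : ‖G x‖ ≤ 400 * ‖x‖ := G.le_of_opNorm_le (norm_lift_le _ _) x

/-- The projection onto the complement of the modes `4` and `11`. -/
noncomputable def offKernel (x : Ell1) : Ell1 := x - x 4 • e 4 - x 11 • e 11

theorem G_L (x : Ell1) : G (L x) = offKernel x := by
  have h : G.comp L = ContinuousLinearMap.id ℝ Ell1 - (coord 4).smulRight (e 4)
      - (coord 11).smulRight (e 11) := by
    refine clm_ext fun n => ?_
    simp only [ContinuousLinearMap.comp_apply, _root_.sub_apply,
      ContinuousLinearMap.id_apply, ContinuousLinearMap.smulRight_apply, coord_apply]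
    by_cases h3 : 3 ≤ n
    · rw [L_e_of_three_le h3, map_smul, G_e]
      by_cases h4 : n = 4
      · subst h4; simp [e_apply]
      · by_cases h11 : n = 11
        · subst h11; simp [e_apply]
        · rw [invVal_of_three_le h3 h4 h11, e_apply_ne (Ne.symm h4), e_apply_ne (Ne.symm h11),
            smul_smul, zero_smul, zero_smul, sub_zero, sub_zero]
          have h1 := symbol_ne_zero h4 h11
          have h2 : (n : ℝ) + 1 ≠ 0 := by positivity
          have : -(((n : ℝ) - 4) * ((n : ℝ) - 11)) / (15 * ((n : ℝ) + 1) ^ 2) *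
            (-(15 * ((n : ℝ) + 1) ^ 2) / (((n : ℝ) - 4) * ((n : ℝ) - 11))) = 1 := by
            rw [mul_comm, div_mul_div_comm, mul_neg, neg_mul, neg_neg, mul_comm]
            exact div_self (by positivity)
          rw [this, one_smul]
    · interval_cases n
      · rw [L_e_zero, map_add, map_smul, map_smul, G_e, G_e]
        norm_num [invVal, e_apply]
        module
      · rw [L_e_one, map_smul, G_e]
        norm_num [invVal, e_apply]
      · rw [L_e_two, map_add, map_smul, map_smul, G_e, G_e]
        norm_num [invVal, e_apply]
        module
  exact congrArg (fun f : Ell1 →L[ℝ] Ell1 => f x) h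

theorem L_G (x : Ell1) : L (G x) = offKernel x := by
  have h : L.comp G = ContinuousLinearMap.id ℝ Ell1 - (coord 4).smulRight (e 4)
      - (coord 11).smulRight (e 11) := by
    refine clm_ext fun n => ?_
    simp only [ContinuousLinearMap.comp_apply, _root_.sub_apply,
      ContinuousLinearMap.id_apply, ContinuousLinearMap.smulRight_apply, coord_apply, G_e]
    by_cases h3 : 3 ≤ n
    · by_cases h4 : n = 4
      · subst h4; simp [e_apply, invVal]
      · by_cases h11 : n = 11
        · subst h11; simp [e_apply, invVal]
        · rw [invVal_of_three_le h3 h4 h11, map_smul, L_e_of_three_le h3,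
            e_apply_ne (Ne.symm h4), e_apply_ne (Ne.symm h11),
            smul_smul, zero_smul, zero_smul, sub_zero, sub_zero]
          have h1 := symbol_ne_zero h4 h11
          have h2 : (n : ℝ) + 1 ≠ 0 := by positivity
          have : (-(15 * ((n : ℝ) + 1) ^ 2) / (((n : ℝ) - 4) * ((n : ℝ) - 11))) *
            (-(((n : ℝ) - 4) * ((n : ℝ) - 11)) / (15 * ((n : ℝ) + 1) ^ 2)) = 1 := by
            rw [div_mul_div_comm, mul_neg, neg_mul, neg_neg, mul_comm]
            exact div_self (by positivity)
          rw [this, one_smul]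
    · interval_cases n
      · norm_num [invVal, e_apply, L_e_zero, L_e_two]
        module
      · norm_num [invVal, e_apply, L_e_one]
      · norm_num [invVal, e_apply, L_e_zero, L_e_two]
        module
  exact congrArg (fun f : Ell1 →L[ℝ] Ell1 => f x) h

theorem L_e_four : L (e 4) = 0 := by rw [L_e_of_three_le (by norm_num)]; norm_num

theorem L_e_eleven : L (e 11) = 0 := by rw [L_e_of_three_le (by norm_num)]; norm_num

theorem L_offKernel (x : Ell1) : L (offKernel x) = L x := by
  simp [offKernel, L_e_four, L_e_eleven]

theorem G_M_offKernel (x : Ell1) : G (M (offKernel x)) = G (M x) := by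
  simp [offKernel, invVal]

theorem offKernel_apply_four (x : Ell1) : offKernel x 4 = 0 := by
  simp [offKernel, e_apply]

theorem offKernel_apply_eleven (x : Ell1) : offKernel x 11 = 0 := by
  simp [offKernel, e_apply]

theorem G_apply_four (x : Ell1) : G x 4 = 0 := by
  have h : (coord 4).comp G = 0 := clm_ext fun n => by
    simp only [ContinuousLinearMap.comp_apply, G_e, coord_apply, _root_.zero_apply]
    unfold invVal
    split_ifs with h0 h1 h2 h3
    · simp [e_apply]
    · simp [e_apply]
    · simp [e_apply]
    · simp
    · simp [e_apply]; omega
  exact congrArg (fun f : Ell1 →L[ℝ] ℝ => f x) h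

theorem G_apply_eleven (x : Ell1) : G x 11 = 0 := by
  have h : (coord 11).comp G = 0 := clm_ext fun n => by
    simp only [ContinuousLinearMap.comp_apply, G_e, coord_apply, _root_.zero_apply]
    unfold invVal
    split_ifs with h0 h1 h2 h3
    · simp [e_apply]
    · simp [e_apply]
    · simp [e_apply]
    · simp
    · simp [e_apply]; omega
  exact congrArg (fun f : Ell1 →L[ℝ] ℝ => f x) h

/-! ### Lyapunov–Schmidt reduction -/

/-- The bilinear part of the nonlinearity at the second eigenmode. -/
noncomputable def B (x y : Ell1) : Ell1 := T (e 1) x y + T x (e 1) y + T x y (e 1)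

theorem B_add_add (x y : Ell1) : B (x + y) (x + y) = B x x + (B x y + B y x + B y y) := by
  simp only [B, map_add, _root_.add_apply]
  abel

theorem B_smul_smul (c : ℝ) (x y : Ell1) : B (c • x) (c • y) = c ^ 2 • B x y := by
  simp only [B, map_smul, _root_.smul_apply, smul_add, smul_smul, sq]

/-- The nonlinear remainder at the second eigenmode. -/
noncomputable def nonlin (a : Ell1) : Ell1 := B a a + T a a a

theorem stationary_iff (Δ : ℝ) (a : Ell1) :
    Stationary (1 / 15 + Δ) (e 1 + a) ↔ L a = Δ • M a + nonlin a := by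
  have h1 : T (e 1 + a) (e 1 + a) (e 1 + a) = T (e 1) (e 1) (e 1)
      + (T (e 1) (e 1) a + T (e 1) a (e 1) + T a (e 1) (e 1)) + nonlin a := by
    simp only [nonlin, B, map_add, _root_.add_apply]
    abel
  have h2 : (Stationary (1 / 15 + Δ) (e 1 + a)) ↔ ∀ n, L a n = (Δ • M a + nonlin a) n := by
    refine forall_congr' fun n => ?_
    have h3 := stationary_e_one (1 / 15 + Δ) n
    have h4 : L a n = (1 - ((n : ℝ) - 1) * (1 / 15)) / ((n : ℝ) + 1) * a n
        - T (e 1) (e 1) a n - T (e 1) a (e 1) n - T a (e 1) (e 1) n := by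
      rw [L_apply]
      simp
    rw [h1, h4]
    simp only [add_apply, smul_apply, M_apply]
    have hn : (n : ℝ) + 1 ≠ 0 := by positivity
    have h5 : (1 - ((n : ℝ) - 1) * (1 / 15 + Δ)) / ((n : ℝ) + 1) * (e 1 n + a n)
      = (1 - ((n : ℝ) - 1) * (1 / 15 + Δ)) / ((n : ℝ) + 1) * e 1 n
        + (1 - ((n : ℝ) - 1) * (1 / 15)) / ((n : ℝ) + 1) * a n
        - Δ * (((n : ℝ) - 1) / ((n : ℝ) + 1) * a n) := by
      field_simp
      ring
    rw [h5, h3]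
    constructor <;> intro h <;> linarith
  rw [h2]
  constructor
  · intro h
    ext n
    exact h n
  · intro h n
    rw [h]

/-- The equation on the complement of the kernel. -/
def Auxiliary (Δ : ℝ) (a : Ell1) : Prop :=
  offKernel a = G (Δ • M (offKernel a) + nonlin a)

/-- The equation in the `κ`-th mode, for `κ` a mode in the kernel. -/
def Reduced (κ : ℕ) (Δ : ℝ) (a : Ell1) : Prop :=
  Δ * (((κ : ℝ) - 1) / ((κ : ℝ) + 1)) * a κ + nonlin a κ = 0

theorem lyapunovSchmidt (Δ : ℝ) (a : Ell1) :
    Stationary (1 / 15 + Δ) (e 1 + a) ↔ Auxiliary Δ a ∧ Reduced 4 Δ a ∧ Reduced 11 Δ a := by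
  rw [stationary_iff]
  have hG : G (Δ • M (offKernel a) + nonlin a) = G (Δ • M a + nonlin a) := by
    rw [map_add, map_add, map_smul, map_smul, G_M_offKernel]
  have hr : ∀ κ, (Δ • M a + nonlin a) κ =
      Δ * (((κ : ℝ) - 1) / ((κ : ℝ) + 1)) * a κ + nonlin a κ := by
    intro κ
    simp only [add_apply, smul_apply, M_apply]
    ring
  rw [Auxiliary, hG]
  constructor
  · intro h
    -- This becomes L a = offKernel (L a): the range of L has no component in the modes 4 and 11.
    have h0 := L_G (L a)
    rw [G_L, L_offKernel] at h0
    refine ⟨by rw [← h, G_L], ?_, ?_⟩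
    · rw [Reduced, ← hr, ← h, h0, offKernel_apply_four]
    · rw [Reduced, ← hr, ← h, h0, offKernel_apply_eleven]
  · rintro ⟨h1, h2, h3⟩
    rw [Reduced, ← hr] at h2 h3
    rw [← L_offKernel, h1, L_G, offKernel, h2, h3]
    simp

/-! ### Invariance of the class of 1 modulo 3 and modulo 10 -/

/-- The projection killing the modes congruent to `1` modulo `d`. -/
noncomputable def offClass (d : ℕ) : Ell1 →L[ℝ] Ell1 :=
  diag (C := 1) (fun n => if n % d = 1 then 0 else 1) fun n => by split_ifs <;> simp

theorem offClass_apply (d : ℕ) (x : Ell1) (n : ℕ) :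
    offClass d x n = if n % d = 1 then 0 else x n := by
  rw [offClass, diag_apply]; split_ifs <;> simp

theorem offClass_e (d n : ℕ) : offClass d (e n) = if n % d = 1 then 0 else e n := by
  rw [offClass, diag_e]; split_ifs <;> simp

theorem norm_offClass_le (d : ℕ) (x : Ell1) : ‖offClass d x‖ ≤ ‖x‖ := by
  have := (offClass d).le_of_opNorm_le (norm_diag_le _ _) x
  simpa using this

theorem norm_sub_offClass_le (d : ℕ) (x : Ell1) : ‖x - offClass d x‖ ≤ ‖x‖ := by
  have hb : ∀ n : ℕ, |if n % d = 1 then (1 : ℝ) else 0| ≤ 1 := fun n => by split_ifs <;> simp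
  have h : x - offClass d x = diag (fun n => if n % d = 1 then (1 : ℝ) else 0) hb x := by
    ext n
    have := offClass_apply d x n
    simp only [sub_apply, diag_apply, this]
    split_ifs <;> simp
  rw [h]
  have := (diag (fun n => if n % d = 1 then (1 : ℝ) else 0) hb).le_of_opNorm_le
    (norm_diag_le _ _) x
  simpa using this

theorem offClass_M (d : ℕ) (x : Ell1) : offClass d (M x) = M (offClass d x) := by
  ext n
  rw [offClass_apply, M_apply, M_apply, offClass_apply]
  split_ifs <;> simp

/-- The only modes coupled by G are 0 and 2, and both lie outside the class of 1 for either modulus.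
-/
theorem offClass_G {d : ℕ} (hd : d = 3 ∨ d = 10) (x : Ell1) :
    offClass d (G x) = G (offClass d x) := by
  have h : (offClass d).comp G = G.comp (offClass d) := by
    refine clm_ext fun n => ?_
    simp only [ContinuousLinearMap.comp_apply, G_e, offClass_e]
    by_cases h3 : 3 ≤ n
    · by_cases h : n = 4 ∨ n = 11
      · have : invVal n = 0 := by rcases h with rfl | rfl <;> simp [invVal]
        split_ifs <;> simp [this]
      · push Not at h
        rw [invVal_of_three_le h3 h.1 h.2, map_smul, offClass_e]
        split_ifs
        · simp
        · rw [G_e, invVal_of_three_le h3 h.1 h.2]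
    · rcases hd with rfl | rfl <;> interval_cases n <;> simp [invVal, offClass_e]
  exact congrArg (fun f : Ell1 →L[ℝ] Ell1 => f x) h

/-- If j, k, m ≡ 1 then n = k + m - j ≡ 1. -/
theorem offClass_T_eq_zero {d : ℕ} (hd : d = 3 ∨ d = 10) (x y z : Ell1) :
    offClass d (T (x - offClass d x) (y - offClass d y) (z - offClass d z)) = 0 := by
  ext n
  rw [offClass_apply, zero_apply]
  split_ifs with hn
  · rfl
  have h1 := T_hasSum (x - offClass d x) (y - offClass d y) (z - offClass d z) n
  have h2 : (fun j => ∑ k ∈ Finset.range (n + j + 1),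
      (interaction n j k (n + j - k) : ℝ) * (x - offClass d x) j * (y - offClass d y) k
        * (z - offClass d z) (n + j - k)) = fun _ => 0 := by
    funext j
    refine Finset.sum_eq_zero fun k hk => ?_
    rw [Finset.mem_range] at hk
    simp only [sub_apply, offClass_apply]
    by_cases hj : j % d = 1
    · by_cases hk' : k % d = 1
      · have : ¬ (n + j - k) % d = 1 := by rcases hd with rfl | rfl <;> omega
        simp [this]
      · simp [hk']
    · simp [hj]
  rw [h2] at h1
  have h3 := h1.unique hasSum_zero
  have hn : ((n : ℝ) + 1) ^ 2 ≠ 0 := by positivity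
  exact (mul_eq_zero.1 h3).resolve_left hn

/-- Replace the arguments one at a time by their parts in the class. The term with all three in the
class is killed, so every remaining one carries an off-class factor. -/
theorem norm_offClass_T_le {d : ℕ} (hd : d = 3 ∨ d = 10) (x y z : Ell1) :
    ‖offClass d (T x y z)‖ ≤ ‖offClass d x‖ * ‖y‖ * ‖z‖ + ‖x‖ * ‖offClass d y‖ * ‖z‖
      + ‖x‖ * ‖y‖ * ‖offClass d z‖ := by
  set P := offClass d
  have h0 := offClass_T_eq_zero hd x y z
  have h1 : P (T x y z) = P (T (P x) y z) + P (T (x - P x) (P y) z)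
      + P (T (x - P x) (y - P y) (P z)) := by
    have : T x y z = T (P x) y z + T (x - P x) (P y) z + T (x - P x) (y - P y) (P z)
      + T (x - P x) (y - P y) (z - P z) := by
      simp only [map_sub, _root_.sub_apply]
      abel
    conv_lhs => rw [this]
    rw [map_add, h0, add_zero, map_add, map_add]
  rw [h1]
  refine norm_add₃_le.trans (add_le_add (add_le_add ?_ ?_) ?_)
  · exact (norm_offClass_le d _).trans (norm_T_le _ _ _)
  · refine (norm_offClass_le d _).trans ((norm_T_le _ _ _).trans ?_)
    gcongr
    exact norm_sub_offClass_le d x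
  · refine (norm_offClass_le d _).trans ((norm_T_le _ _ _).trans ?_)
    gcongr
    · exact norm_sub_offClass_le d x
    · exact norm_sub_offClass_le d y

/-! ### Quadratic and cubic terms on the kernel -/

/-- The kernel component. -/
noncomputable def onKernel (x : Ell1) : Ell1 := x 4 • e 4 + x 11 • e 11

theorem onKernel_add_offKernel (x : Ell1) : onKernel x + offKernel x = x := by
  simp only [onKernel, offKernel]; abel

theorem B_onKernel (s t : ℝ) : B (s • e 4 + t • e 11) (s • e 4 + t • e 11) =
    (s ^ 2) • ((1 / 32 : ℝ) • e 7 + e 1) + (s * t) • ((4 / 225 : ℝ) • e 14 + (4 / 81 : ℝ) • e 8)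
      + (t ^ 2) • ((1 / 242 : ℝ) • e 21 + e 1) := by
  simp only [B, map_add, map_smul, _root_.add_apply, _root_.smul_apply, T_e]
  norm_num [interaction]
  module

theorem G_B_onKernel (s t : ℝ) : G (B (s • e 4 + t • e 11) (s • e 4 + t • e 11)) =
    (s ^ 2) • ((5 / 2 : ℝ) • e 7 - e 1) + (s * t) • ((-2 : ℝ) • e 14 + (5 : ℝ) • e 8)
      + (t ^ 2) • ((-3 / 17 : ℝ) • e 21 - e 1) := by
  rw [B_onKernel]
  simp only [map_add, map_smul, G_e]
  norm_num [invVal]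
  module

/-- The quadratic terms land only in the modes 1, 7, 8, 14, 21, so the reduced equations start at
third order. -/
theorem B_onKernel_apply_four (s t : ℝ) :
    B (s • e 4 + t • e 11) (s • e 4 + t • e 11) 4 = 0 := by
  rw [B_onKernel]
  simp [e_apply]

theorem B_onKernel_apply_eleven (s t : ℝ) :
    B (s • e 4 + t • e 11) (s • e 4 + t • e 11) 11 = 0 := by
  rw [B_onKernel]
  simp [e_apply]

/-- The cubic part of the reduced equations. -/
noncomputable def cubicPart (p : Ell1) : Ell1 := B p (G (B p p)) + B (G (B p p)) p + T p p p

theorem cubicPart_onKernel_four (s t : ℝ) : cubicPart (s • e 4 + t • e 11) 4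
    = (7 / 25 * s ^ 2 + 14 / 25 * t ^ 2) * s := by
  rw [cubicPart, G_B_onKernel]
  simp only [B, map_add, map_sub, map_smul, _root_.add_apply, _root_.sub_apply,
    _root_.smul_apply, T_e]
  norm_num [interaction]
  simp [e_apply]
  ring

theorem cubicPart_onKernel_eleven (s t : ℝ) : cubicPart (s • e 4 + t • e 11) 11
    = (7 / 72 * s ^ 2 + 7 / 306 * t ^ 2) * t := by
  rw [cubicPart, G_B_onKernel]
  simp only [B, map_add, map_sub, map_smul, _root_.add_apply, _root_.sub_apply,
    _root_.smul_apply, T_e]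
  norm_num [interaction]
  simp [e_apply]
  ring

/-! ### Weighted norms measuring the off-class part -/

/-- The norm of `ℓ¹(ℕ)` with an additional weight `l` off the class of `1` modulo `d`. -/
noncomputable def wnorm (d : ℕ) (l : ℝ) (x : Ell1) : ℝ := ‖x‖ + l * ‖offClass d x‖

section WeightedNorm

variable {d : ℕ} {l : ℝ}

theorem wnorm_nonneg (hl : 0 ≤ l) (x : Ell1) : 0 ≤ wnorm d l x := by
  unfold wnorm; positivity

theorem wnorm_add_le (hl : 0 ≤ l) (x y : Ell1) :
    wnorm d l (x + y) ≤ wnorm d l x + wnorm d l y := by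
  unfold wnorm
  rw [map_add]
  have h1 := norm_add_le x y
  have h2 := mul_le_mul_of_nonneg_left (norm_add_le (offClass d x) (offClass d y)) hl
  linarith

theorem wnorm_smul (c : ℝ) (x : Ell1) : wnorm d l (c • x) = |c| * wnorm d l x := by
  unfold wnorm
  rw [map_smul, norm_smul, norm_smul, Real.norm_eq_abs]
  ring

/-- The off-class estimate supplies the terms of order at most one in l of the expanded product;
those in l² and l³ are nonnegative. Order counting in the amplitudes therefore also works for
off-class parts. -/
theorem wnorm_T_le (hd : d = 3 ∨ d = 10) (hl : 0 ≤ l) (x y z : Ell1) :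
    wnorm d l (T x y z) ≤ wnorm d l x * wnorm d l y * wnorm d l z := by
  have h1 := norm_T_le x y z
  have h2 := mul_le_mul_of_nonneg_left (norm_offClass_T_le hd x y z) hl
  unfold wnorm
  have h3 : 0 ≤ l ^ 2 * (‖offClass d x‖ * ‖offClass d y‖ * ‖z‖
      + ‖offClass d x‖ * ‖y‖ * ‖offClass d z‖ + ‖x‖ * ‖offClass d y‖ * ‖offClass d z‖)
      + l ^ 3 * (‖offClass d x‖ * ‖offClass d y‖ * ‖offClass d z‖) := by positivity
  nlinarith

theorem wnorm_e_one (hd : d = 3 ∨ d = 10) : wnorm d l (e 1) = 1 := by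
  have : 1 % d = 1 := by rcases hd with rfl | rfl <;> rfl
  simp [wnorm, offClass_e, this]

theorem wnorm_B_le (hd : d = 3 ∨ d = 10) (hl : 0 ≤ l) (x y : Ell1) :
    wnorm d l (B x y) ≤ 3 * (wnorm d l x * wnorm d l y) := by
  have h1 := wnorm_T_le hd hl (e 1) x y
  have h2 := wnorm_T_le hd hl x (e 1) y
  have h3 := wnorm_T_le hd hl x y (e 1)
  rw [wnorm_e_one hd] at h1 h2 h3
  have h4 := wnorm_add_le (d := d) hl (T (e 1) x y + T x (e 1) y) (T x y (e 1))
  have h5 := wnorm_add_le (d := d) hl (T (e 1) x y) (T x (e 1) y)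
  unfold B
  linarith

theorem wnorm_G_le (hd : d = 3 ∨ d = 10) (hl : 0 ≤ l) (x : Ell1) :
    wnorm d l (G x) ≤ 400 * wnorm d l x := by
  unfold wnorm
  rw [offClass_G hd]
  have h1 := norm_G_le x
  have h2 := mul_le_mul_of_nonneg_left (norm_G_le (offClass d x)) hl
  linarith

theorem wnorm_M_le (hl : 0 ≤ l) (x : Ell1) : wnorm d l (M x) ≤ wnorm d l x := by
  unfold wnorm
  rw [offClass_M]
  have h1 := norm_M_le x
  have h2 := mul_le_mul_of_nonneg_left (norm_M_le (offClass d x)) hl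
  linarith

theorem mul_abs_apply_le_wnorm (hl : 0 ≤ l) {κ : ℕ} (hκ : κ % d ≠ 1) (x : Ell1) :
    l * |x κ| ≤ wnorm d l x := by
  have h1 := abs_apply_le (offClass d x) κ
  rw [offClass_apply, if_neg hκ] at h1
  have h2 := mul_le_mul_of_nonneg_left h1 hl
  unfold wnorm
  linarith [norm_nonneg x]

end WeightedNorm

/-! ### A priori bounds for the auxiliary equation -/

/-- The size of the kernel component. -/
noncomputable def amplitude (x : Ell1) : ℝ := |x 4| + |x 11|

theorem amplitude_nonneg (x : Ell1) : 0 ≤ amplitude x := by unfold amplitude; positivity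

theorem amplitude_le (x : Ell1) : amplitude x ≤ 2 * ‖x‖ := by
  have h1 := abs_apply_le x 4
  have h2 := abs_apply_le x 11
  unfold amplitude; linarith

theorem norm_onKernel_le (x : Ell1) : ‖onKernel x‖ ≤ amplitude x := by
  refine (norm_add_le _ _).trans ?_
  simp [norm_smul, amplitude]

theorem norm_nonlin_le {a : Ell1} (ha : ‖a‖ ≤ 1) : ‖nonlin a‖ ≤ 4 * ‖a‖ ^ 2 := by
  have h1 := norm_T_le (e 1) a a
  have h2 := norm_T_le a (e 1) a
  have h3 := norm_T_le a a (e 1)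
  have h4 := norm_T_le a a a
  rw [norm_e] at h1 h2 h3
  have h5 : ‖nonlin a‖ ≤ ‖T (e 1) a a‖ + ‖T a (e 1) a‖ + ‖T a a (e 1)‖ + ‖T a a a‖ :=
    (norm_add_le _ _).trans (add_le_add_left norm_add₃_le _)
  have h6 : ‖a‖ * ‖a‖ * ‖a‖ ≤ ‖a‖ * ‖a‖ * 1 := by gcongr
  linarith

theorem norm_offClass_nonlin_le {d : ℕ} (hd : d = 3 ∨ d = 10) {a : Ell1} (ha : ‖a‖ ≤ 1) :
    ‖offClass d (nonlin a)‖ ≤ 9 * (‖a‖ * ‖offClass d a‖) := by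
  have h0 : offClass d (e 1) = 0 := by
    have : 1 % d = 1 := by rcases hd with rfl | rfl <;> rfl
    simp [offClass_e, this]
  have h1 := norm_offClass_T_le hd (e 1) a a
  have h2 := norm_offClass_T_le hd a (e 1) a
  have h3 := norm_offClass_T_le hd a a (e 1)
  have h4 := norm_offClass_T_le hd a a a
  rw [norm_e, h0, norm_zero] at h1 h2 h3
  have h5 : ‖offClass d (nonlin a)‖ ≤ ‖offClass d (T (e 1) a a)‖ + ‖offClass d (T a (e 1) a)‖
      + ‖offClass d (T a a (e 1))‖ + ‖offClass d (T a a a)‖ := by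
    simp only [nonlin, B, map_add]
    exact (norm_add_le _ _).trans (add_le_add_left norm_add₃_le _)
  have h6 : ‖a‖ * (‖a‖ * ‖offClass d a‖) ≤ 1 * (‖a‖ * ‖offClass d a‖) := by gcongr
  nlinarith

/-- Since ‖G‖ ≤ 400, the condition |Δ| ≤ 1/800 lets half of the left-hand side absorb the Δ-term. -/
theorem Auxiliary.norm_offKernel_le {Δ : ℝ} {a : Ell1} (h : Auxiliary Δ a)
    (hΔ : |Δ| ≤ 1 / 800) (ha : ‖a‖ ≤ 1) : ‖offKernel a‖ ≤ 3200 * ‖a‖ ^ 2 := by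
  have h1 : ‖offKernel a‖ ≤ 400 * (|Δ| * ‖offKernel a‖ + ‖nonlin a‖) := by
    conv_lhs => rw [h]
    refine (norm_G_le _).trans ?_
    gcongr
    refine (norm_add_le _ _).trans ?_
    rw [norm_smul, Real.norm_eq_abs]
    gcongr
    exact norm_M_le _
  have h2 := norm_nonlin_le ha
  have h3 := mul_le_mul_of_nonneg_right hΔ (norm_nonneg (offKernel a))
  linarith

theorem Auxiliary.norm_le_amplitude {Δ : ℝ} {a : Ell1} (h : Auxiliary Δ a)
    (hΔ : |Δ| ≤ 1 / 800) (ha : ‖a‖ ≤ 1 / 14400) : ‖a‖ ≤ 2 * amplitude a := by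
  have h1 := h.norm_offKernel_le hΔ (ha.trans (by norm_num))
  have h2 : ‖a‖ ≤ amplitude a + ‖offKernel a‖ := by
    conv_lhs => rw [← onKernel_add_offKernel a]
    exact (norm_add_le _ _).trans (add_le_add_left (norm_onKernel_le a) _)
  nlinarith [norm_nonneg a]

theorem Auxiliary.norm_offKernel_le_amplitude {Δ : ℝ} {a : Ell1} (h : Auxiliary Δ a)
    (hΔ : |Δ| ≤ 1 / 800) (ha : ‖a‖ ≤ 1 / 14400) : ‖offKernel a‖ ≤ 12800 * amplitude a ^ 2 := by
  have h1 := h.norm_offKernel_le hΔ (ha.trans (by norm_num))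
  have h2 := pow_le_pow_left₀ (norm_nonneg a) (h.norm_le_amplitude hΔ ha) 2
  linarith

/-- The off-class part of the solution is driven by the off-class part of its kernel component
alone. The radius 1/14400 absorbs the self-interaction. -/
theorem Auxiliary.norm_offClass_le {d : ℕ} (hd : d = 3 ∨ d = 10) {Δ : ℝ} {a : Ell1}
    (h : Auxiliary Δ a) (hΔ : |Δ| ≤ 1 / 800) (ha : ‖a‖ ≤ 1 / 14400) :
    ‖offClass d (offKernel a)‖ ≤ 14400 * (‖a‖ * ‖offClass d (onKernel a)‖) := by
  have h1 : ‖offClass d (offKernel a)‖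
      ≤ 400 * (|Δ| * ‖offClass d (offKernel a)‖ + ‖offClass d (nonlin a)‖) := by
    conv_lhs => rw [h]
    rw [offClass_G hd, map_add, map_smul, offClass_M]
    refine (norm_G_le _).trans ?_
    gcongr
    refine (norm_add_le _ _).trans ?_
    rw [norm_smul, Real.norm_eq_abs]
    gcongr
    exact norm_M_le _
  have h2 := norm_offClass_nonlin_le hd (ha.trans (by norm_num))
  have h3 := mul_le_mul_of_nonneg_right hΔ (norm_nonneg (offClass d (offKernel a)))
  have h4 : ‖offClass d a‖ ≤ ‖offClass d (onKernel a)‖ + ‖offClass d (offKernel a)‖ := by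
    conv_lhs => rw [← onKernel_add_offKernel a, map_add]
    exact norm_add_le _ _
  have h5 := mul_le_mul_of_nonneg_left h4 (norm_nonneg a)
  have h6 := mul_le_mul_of_nonneg_right ha (norm_nonneg (offClass d (offKernel a)))
  linarith

/-! ### Error of the cubic approximation -/

theorem nonlin_add (p w : Ell1) :
    nonlin (p + w) = B p p + (B p w + B w p + B w w) + T (p + w) (p + w) (p + w) := by
  rw [nonlin, B_add_add]

/-- Here w is approximated to second order by G (B p p), with error r; what remains beyond the cubic
part involves r or is at least quartic when p is of first and w of second order. -/
theorem nonlin_sub_cubicPart (p w r : Ell1) (hr : r = w - G (B p p)) :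
    nonlin (p + w) - B p p - cubicPart p = B p r + B r p + B w w
      + (T p p w + T p w p + T p w w + T w p p + T w p w + T w w p + T w w w) := by
  have h1 : B p r = B p w - B p (G (B p p)) := by
    rw [hr]; simp only [B, map_sub, _root_.sub_apply]; abel
  have h2 : B r p = B w p - B (G (B p p)) p := by
    rw [hr]; simp only [B, map_sub, _root_.sub_apply]; abel
  have h3 : T (p + w) (p + w) (p + w) = T p p p
      + (T p p w + T p w p + T p w w + T w p p + T w p w + T w w p + T w w w) := by
    simp only [map_add, _root_.add_apply]
    abel
  rw [h1, h2, nonlin_add, h3, cubicPart]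
  abel

theorem Auxiliary.offKernel_sub_eq {Δ : ℝ} {a : Ell1} (h : Auxiliary Δ a) {p w : Ell1}
    (hp : onKernel a = p) (hw : offKernel a = w) :
    w - G (B p p) = G (Δ • M w + (B p w + B w p + B w w) + T a a a) := by
  have haw : a = p + w := by rw [← hp, ← hw, onKernel_add_offKernel]
  have h1 : nonlin a = B p p + (B p w + B w p + B w w) + T a a a := by
    rw [haw, nonlin_add]
  have h2 : w = G (Δ • M w + nonlin a) := by
    have := h
    rwa [Auxiliary, hw] at this
  conv_lhs => rw [h2]
  rw [← map_sub, h1]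
  congr 1
  abel

theorem wnorm_nonlin_sub_cubicPart_le {d : ℕ} (hd : d = 3 ∨ d = 10) {l : ℝ} (hl : 0 ≤ l) {Δ : ℝ}
    {a : Ell1} (h : Auxiliary Δ a) {ρ : ℝ} (hρ : 0 ≤ ρ) (hρ1 : 50000 * ρ ≤ 1)
    (hp : wnorm d l (onKernel a) ≤ 2 * ρ) (hw : wnorm d l (offKernel a) ≤ 50000 * ρ ^ 2) :
    wnorm d l (nonlin a - B (onKernel a) (onKernel a) - cubicPart (onKernel a))
      ≤ 10 ^ 11 * ((|Δ| + ρ) * ρ ^ 3) := by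
  obtain ⟨p, hpdef⟩ : ∃ p, onKernel a = p := ⟨_, rfl⟩
  obtain ⟨w, hwdef⟩ : ∃ w, offKernel a = w := ⟨_, rfl⟩
  have hawp : a = p + w := by rw [← hpdef, ← hwdef, onKernel_add_offKernel]
  rw [hpdef] at hp ⊢
  rw [hwdef] at hw
  have hp0 := wnorm_nonneg (d := d) hl p
  have hw0 := wnorm_nonneg (d := d) hl w
  have hw1 : wnorm d l w ≤ ρ := by nlinarith
  have ha : wnorm d l a ≤ 3 * ρ := by
    rw [hawp]
    linarith [wnorm_add_le (d := d) hl p w]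
  have ha0 := wnorm_nonneg (d := d) hl a
  obtain ⟨r, hr⟩ : ∃ r, r = w - G (B p p) := ⟨_, rfl⟩
  have hrG : r = G (Δ • M w + (B p w + B w p + B w w) + T a a a) :=
    hr.trans (h.offKernel_sub_eq hpdef hwdef)
  have bpw : wnorm d l p * wnorm d l w ≤ 2 * ρ * (50000 * ρ ^ 2) := by gcongr
  have bww : wnorm d l w * wnorm d l w ≤ ρ * (50000 * ρ ^ 2) := by gcongr
  have bBpw := wnorm_B_le hd hl p w
  have bBwp := wnorm_B_le hd hl w p
  have bBww := wnorm_B_le hd hl w w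
  have hrle : wnorm d l r ≤ 400 * (10 ^ 6 * ((|Δ| + ρ) * ρ ^ 2)) := by
    rw [hrG]
    refine (wnorm_G_le hd hl _).trans ?_
    refine mul_le_mul_of_nonneg_left ?_ (by norm_num)
    have t1 := wnorm_add_le (d := d) hl (Δ • M w + (B p w + B w p + B w w)) (T a a a)
    have t2 := wnorm_add_le (d := d) hl (Δ • M w) (B p w + B w p + B w w)
    have t3 := wnorm_add_le (d := d) hl (B p w + B w p) (B w w)
    have t4 := wnorm_add_le (d := d) hl (B p w) (B w p)
    have t5 := wnorm_T_le hd hl a a a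
    have t6 : wnorm d l a * wnorm d l a * wnorm d l a ≤ (3 * ρ) * (3 * ρ) * (3 * ρ) := by gcongr
    have t7 : wnorm d l (Δ • M w) ≤ |Δ| * (50000 * ρ ^ 2) := by
      rw [wnorm_smul]
      gcongr
      exact (wnorm_M_le hl w).trans hw
    have t8 : 0 ≤ |Δ| * ρ ^ 2 := by positivity
    have t9 : 0 ≤ ρ ^ 3 := by positivity
    linarith
  have hr0 := wnorm_nonneg (d := d) hl r
  have hdec := nonlin_sub_cubicPart p w r hr
  rw [← hawp] at hdec
  rw [hdec]
  have s1 := wnorm_add_le (d := d) hl (B p r + B r p + B w w)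
      (T p p w + T p w p + T p w w + T w p p + T w p w + T w w p + T w w w)
  have s2 := wnorm_add_le (d := d) hl (B p r + B r p) (B w w)
  have s3 := wnorm_add_le (d := d) hl (B p r) (B r p)
  have s4 := wnorm_add_le (d := d) hl (T p p w + T p w p + T p w w + T w p p + T w p w + T w w p)
    (T w w w)
  have s5 := wnorm_add_le (d := d) hl (T p p w + T p w p + T p w w + T w p p + T w p w) (T w w p)
  have s6 := wnorm_add_le (d := d) hl (T p p w + T p w p + T p w w + T w p p) (T w p w)
  have s7 := wnorm_add_le (d := d) hl (T p p w + T p w p + T p w w) (T w p p)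
  have s8 := wnorm_add_le (d := d) hl (T p p w + T p w p) (T p w w)
  have s9 := wnorm_add_le (d := d) hl (T p p w) (T p w p)
  have cub : ∀ x y z : Ell1, wnorm d l x ≤ 2 * ρ → wnorm d l y ≤ 2 * ρ →
      wnorm d l z ≤ 50000 * ρ ^ 2 →
      wnorm d l x * wnorm d l y * wnorm d l z ≤ 200000 * ρ ^ 4 := by
    intro x y z hx hy hz
    have := wnorm_nonneg (d := d) hl x
    have := wnorm_nonneg (d := d) hl y
    have := wnorm_nonneg (d := d) hl z
    calc _ ≤ (2 * ρ) * (2 * ρ) * (50000 * ρ ^ 2) := by gcongr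
      _ = _ := by ring
  have hw2 : wnorm d l w ≤ 2 * ρ := by linarith
  have u1 := (wnorm_T_le hd hl p p w).trans (cub p p w hp hp hw)
  have u2 := (wnorm_T_le hd hl p w p).trans ((mul_right_comm _ _ _).trans_le
    (cub p p w hp hp hw))
  have u3 := (wnorm_T_le hd hl p w w).trans (cub p w w hp hw2 hw)
  have u4 := (wnorm_T_le hd hl w p p).trans (by
    have := cub p p w hp hp hw
    calc wnorm d l w * wnorm d l p * wnorm d l p = wnorm d l p * wnorm d l p * wnorm d l w := by
          ring
      _ ≤ _ := this)
  have u5 := (wnorm_T_le hd hl w p w).trans (cub w p w hw2 hp hw)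
  have u6 := (wnorm_T_le hd hl w w p).trans ((mul_right_comm _ _ _).trans_le
    (cub w p w hw2 hp hw))
  have u7 := (wnorm_T_le hd hl w w w).trans (cub w w w hw2 hw2 hw)
  have v1 := wnorm_B_le hd hl p r
  have v2 := wnorm_B_le hd hl r p
  have v3 : wnorm d l p * wnorm d l r ≤ 2 * ρ * (400 * (10 ^ 6 * ((|Δ| + ρ) * ρ ^ 2))) := by
    gcongr
  have v4 : wnorm d l w * wnorm d l w ≤ (50000 * ρ ^ 2) * (50000 * ρ ^ 2) := by gcongr
  have v5 : 0 ≤ |Δ| * ρ ^ 3 := by positivity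
  have v6 : 0 ≤ ρ ^ 4 := by positivity
  linarith

/-- The factor |a κ| on the right is essential: it allows division of the reduced equation by a κ,
however small a κ is compared with the other amplitude. Here κ is the kernel mode outside the class.
-/
theorem Auxiliary.abs_nonlin_sub_le {d κ : ℕ} (hd : d = 3 ∨ d = 10) (hκ : κ % d ≠ 1) {Δ : ℝ}
    {a : Ell1} (h : Auxiliary Δ a) (hΔ : |Δ| ≤ 1 / 800) (ha : ‖a‖ ≤ 1 / 100000)
    (hP : ‖offClass d (onKernel a)‖ ≤ |a κ|) (hκ0 : a κ ≠ 0) (hκρ : |a κ| ≤ amplitude a)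
    (hB : B (onKernel a) (onKernel a) κ = 0) :
    |nonlin a κ - cubicPart (onKernel a) κ|
      ≤ 10 ^ 11 * ((|Δ| + amplitude a) * amplitude a ^ 2) * |a κ| := by
  set ρ := amplitude a with hρ
  have hκp : 0 < |a κ| := abs_pos.2 hκ0
  have hρ0 : 0 < ρ := hκp.trans_le hκρ
  have ha' : ‖a‖ ≤ 1 / 14400 := ha.trans (by norm_num)
  -- With the weight ρ/|a κ|, the off-class kernel component, of size at most |a κ|, contributes
  -- only ρ to the weighted norm. The component in mode κ is weighted likewise, and undoing the
  -- weight produces the factor |a κ|.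
  have hl : 0 ≤ ρ / |a κ| := by positivity
  have hρ1 : 50000 * ρ ≤ 1 := by linarith [amplitude_le a]
  have h1 : wnorm d (ρ / |a κ|) (onKernel a) ≤ 2 * ρ := by
    have h2 := mul_le_mul_of_nonneg_left hP hl
    rw [div_mul_cancel₀ _ hκp.ne'] at h2
    unfold wnorm
    linarith [norm_onKernel_le a]
  have h3 : wnorm d (ρ / |a κ|) (offKernel a) ≤ 50000 * ρ ^ 2 := by
    have h4 := h.norm_offClass_le hd hΔ ha'
    have h5 : ‖a‖ * ‖offClass d (onKernel a)‖ ≤ 2 * ρ * |a κ| := by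
      have := h.norm_le_amplitude hΔ ha'
      gcongr
    have h6 : ‖offClass d (offKernel a)‖ ≤ 28800 * ρ * |a κ| := by linarith
    have h7 := mul_le_mul_of_nonneg_left h6 hl
    have h8 : ρ / |a κ| * (28800 * ρ * |a κ|) = 28800 * ρ ^ 2 := by field_simp
    have h9 := h.norm_offKernel_le_amplitude hΔ ha'
    unfold wnorm
    nlinarith
  have h10 := wnorm_nonlin_sub_cubicPart_le hd hl h hρ0.le hρ1 h1 h3
  have h11 := (mul_abs_apply_le_wnorm hl hκ _).trans h10
  have h12 : (nonlin a - B (onKernel a) (onKernel a) - cubicPart (onKernel a)) κ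
      = nonlin a κ - cubicPart (onKernel a) κ := by
    rw [sub_apply, sub_apply, hB, sub_zero]
  rw [h12] at h11
  rw [div_mul_eq_mul_div, div_le_iff₀ hκp] at h11
  refine le_of_mul_le_mul_left (h11.trans (le_of_eq ?_)) hρ0
  ring

/-! ### The bifurcation equations and the exclusion of mixed solutions -/

theorem abs_sub_le_of_reduced {Δ ρ α m x s : ℝ} (hs : s ≠ 0) (hm : 3 / 5 ≤ m)
    (hρ : 0 ≤ ρ) (hρ1 : ρ ≤ 1 / 10 ^ 6) (hα : |α| ≤ ρ ^ 2) (hx : Δ * m * s + x = 0)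
    (h : |x + α * m * s| ≤ 10 ^ 11 * ((|Δ| + ρ) * ρ ^ 2) * |s|) :
    |Δ - α| ≤ 10 ^ 12 * ρ ^ 3 := by
  have hsp : 0 < |s| := abs_pos.2 hs
  have h1 : x + α * m * s = -((Δ - α) * m * s) := by linarith
  rw [h1, abs_neg, abs_mul, abs_mul, abs_of_pos (by linarith : 0 < m)] at h
  have h2 := le_of_mul_le_mul_right h hsp
  have h3 : |Δ - α| * (3 / 5) ≤ 10 ^ 11 * ((|Δ| + ρ) * ρ ^ 2) :=
    (mul_le_mul_of_nonneg_left hm (abs_nonneg _)).trans h2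
  have h4 : |Δ| ≤ |Δ - α| + |α| := by
    have := abs_add_le (Δ - α) α
    rwa [sub_add_cancel] at this
  have hρ2 : ρ ^ 2 ≤ 1 / 10 ^ 12 := by
    calc ρ ^ 2 ≤ (1 / 10 ^ 6) ^ 2 := by gcongr
      _ = _ := by norm_num
  have hρ3 : ρ ^ 2 ≤ ρ := by nlinarith
  have h5 : 10 ^ 11 * (|Δ| * ρ ^ 2) ≤ 1 / 10 * |Δ| := by nlinarith [abs_nonneg Δ]
  have h6 : 10 ^ 11 * (ρ * ρ ^ 2) ≤ 1 / 10 * ρ := by nlinarith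
  -- A crude bound on Δ first, fed back into `h3` to make the error purely cubic in ρ.
  have h7 : |Δ| ≤ 2 * ρ := by nlinarith [abs_nonneg Δ]
  have h8 : |Δ| * ρ ^ 2 ≤ 2 * ρ * ρ ^ 2 := by gcongr
  nlinarith [pow_nonneg hρ 3]

theorem amplitude_sq_ge (a : Ell1) : a 4 ^ 2 + a 11 ^ 2 ≤ amplitude a ^ 2 := by
  unfold amplitude
  nlinarith [sq_abs (a 4), sq_abs (a 11), abs_nonneg (a 4), abs_nonneg (a 11),
    mul_nonneg (abs_nonneg (a 4)) (abs_nonneg (a 11))]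

theorem amplitude_sq_le (a : Ell1) : amplitude a ^ 2 ≤ 2 * (a 4 ^ 2 + a 11 ^ 2) := by
  unfold amplitude
  nlinarith [sq_abs (a 4), sq_abs (a 11), sq_nonneg (|a 4| - |a 11|)]

/-- Modulus 10 isolates mode 4. The coefficients are those of the cubic part divided by 3/5 =
(4-1)/(4+1). -/
theorem Auxiliary.abs_sub_le_four {Δ : ℝ} {a : Ell1} (h : Auxiliary Δ a)
    (hR : Reduced 4 Δ a) (h4 : a 4 ≠ 0) (hΔ : |Δ| ≤ 1 / 800) (ha : ‖a‖ ≤ 1 / 10 ^ 7) :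
    |Δ - (-(7 / 15) * a 4 ^ 2 - 14 / 15 * a 11 ^ 2)| ≤ 10 ^ 12 * amplitude a ^ 3 := by
  have h1 := h.abs_nonlin_sub_le (d := 10) (κ := 4) (Or.inr rfl) (by norm_num) hΔ
    (ha.trans (by norm_num)) (by simp [onKernel, offClass_e, norm_smul]) h4
    (by unfold amplitude; linarith [abs_nonneg (a 11)])
    (B_onKernel_apply_four _ _)
  rw [onKernel, cubicPart_onKernel_four] at h1
  refine abs_sub_le_of_reduced h4 (m := 3 / 5) le_rfl (amplitude_nonneg a) ?_ ?_
    (x := nonlin a 4) ?_ ?_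
  · have := amplitude_le a
    norm_num at *
    linarith
  · refine le_trans ?_ (amplitude_sq_ge a)
    rw [abs_le]; constructor <;> nlinarith [sq_nonneg (a 4), sq_nonneg (a 11)]
  · have := hR
    unfold Reduced at this
    norm_num at this
    exact this
  · convert! h1 using 2
    ring

/-- Modulus 3 isolates mode 11, and the divisor is 5/6 = (11-1)/(11+1). -/
theorem Auxiliary.abs_sub_le_eleven {Δ : ℝ} {a : Ell1} (h : Auxiliary Δ a)
    (hR : Reduced 11 Δ a) (h11 : a 11 ≠ 0) (hΔ : |Δ| ≤ 1 / 800) (ha : ‖a‖ ≤ 1 / 10 ^ 7) :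
    |Δ - (-(7 / 60) * a 4 ^ 2 - 7 / 255 * a 11 ^ 2)| ≤ 10 ^ 12 * amplitude a ^ 3 := by
  have h1 := h.abs_nonlin_sub_le (d := 3) (κ := 11) (Or.inl rfl) (by norm_num) hΔ
    (ha.trans (by norm_num)) (by simp [onKernel, offClass_e, norm_smul]) h11
    (by unfold amplitude; linarith [abs_nonneg (a 4)])
    (B_onKernel_apply_eleven _ _)
  rw [onKernel, cubicPart_onKernel_eleven] at h1
  refine abs_sub_le_of_reduced h11 (m := 5 / 6) (by norm_num) (amplitude_nonneg a) ?_ ?_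
    (x := nonlin a 11) ?_ ?_
  · have := amplitude_le a
    norm_num at *
    linarith
  · refine le_trans ?_ (amplitude_sq_ge a)
    rw [abs_le]; constructor <;> nlinarith [sq_nonneg (a 4), sq_nonneg (a 11)]
  · have := hR
    unfold Reduced at this
    norm_num at this
    exact this
  · convert! h1 using 2
    ring

/-- Near the bifurcation point no solution has both amplitudes nonzero. -/
theorem Auxiliary.not_mixed {Δ : ℝ} {a : Ell1} (h : Auxiliary Δ a)
    (hR4 : Reduced 4 Δ a) (hR11 : Reduced 11 Δ a) (hΔ : |Δ| ≤ 1 / 800)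
    (ha : ‖a‖ ≤ 1 / 10 ^ 14) : ¬ (a 4 ≠ 0 ∧ a 11 ≠ 0) := by
  rintro ⟨h4, h11⟩
  have ha' : ‖a‖ ≤ 1 / 10 ^ 7 := ha.trans (by norm_num)
  have h1 := abs_le.1 (h.abs_sub_le_four hR4 h4 hΔ ha')
  have h2 := abs_le.1 (h.abs_sub_le_eleven hR11 h11 hΔ ha')
  have h3 := amplitude_sq_le a
  have h5 : amplitude a ≤ 2 / 10 ^ 14 := by linarith [amplitude_le a]
  have h6 : amplitude a ^ 3 ≤ 2 / 10 ^ 14 * amplitude a ^ 2 := by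
    have := mul_le_mul_of_nonneg_right h5 (sq_nonneg (amplitude a))
    linarith
  have h7 : 0 < a 4 ^ 2 := by positivity
  have h8 : 0 < a 11 ^ 2 := by positivity
  -- The two formulas for Δ differ by (7/20)s² + (77/85)t², whereas each error is at most ρ²/50 ≤
  -- (s²+t²)/25.
  linarith [h1.1, h1.2, h2.1, h2.2]

/-! ### The pure branches, by the implicit function theorem -/

/-- `κ` is a mode in the kernel, `κ'` the other one, and `d` a modulus separating them with `κ`
in the class of `1`. -/
def IsKernelPair (κ κ' d : ℕ) : Prop := (κ = 4 ∧ κ' = 11 ∧ d = 3) ∨ (κ = 11 ∧ κ' = 4 ∧ d = 10)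

/-- The nonlinearity at `s • (e κ + w)`, divided by `s`. -/
noncomputable def scaledNonlin (κ : ℕ) (s : ℝ) (w : Ell1) : Ell1 :=
  s • B (e κ + w) (e κ + w) + s ^ 2 • T (e κ + w) (e κ + w) (e κ + w)

theorem nonlin_smul (κ : ℕ) (s : ℝ) (w : Ell1) :
    nonlin (s • (e κ + w)) = s • scaledNonlin κ s w := by
  rw [nonlin, scaledNonlin, B_smul_smul]
  generalize e κ + w = b
  simp only [map_smul, _root_.smul_apply, smul_add, smul_smul]
  congr 2 <;> ring

/-- The desingularized equations for a branch bifurcating in the direction of `e κ`. -/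
noncomputable def branchMap (κ : ℕ) (v : ℝ × (ℝ × Ell1)) : ℝ × Ell1 :=
  (v.2.1 + (((κ : ℝ) - 1) / ((κ : ℝ) + 1))⁻¹ * coord κ (scaledNonlin κ v.1 v.2.2),
    v.2.2 - G (v.2.1 • M v.2.2 + scaledNonlin κ v.1 v.2.2))

theorem contDiff_branchMap (κ : ℕ) : ContDiff ℝ (⊤ : WithTop ℕ∞) (branchMap κ) := by
  unfold branchMap scaledNonlin B
  fun_prop

theorem branchMap_zero (κ : ℕ) : branchMap κ 0 = 0 := by
  simp [branchMap, scaledNonlin]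

/-- At s = 0 the scaled nonlinearity vanishes and the map is (Δ, w) ↦ (Δ, w - Δ G M w), whose
correction to the identity is quadratic. -/
theorem fderiv_branchMap_comp_inr (κ : ℕ) :
    (fderiv ℝ (branchMap κ) 0) ∘L .inr ℝ ℝ (ℝ × Ell1) = ContinuousLinearMap.id ℝ (ℝ × Ell1) := by
  have h1 : HasFDerivAt (branchMap κ) (fderiv ℝ (branchMap κ) 0)
      (ContinuousLinearMap.inr ℝ ℝ (ℝ × Ell1) 0) := by
    rw [map_zero]
    exact ((contDiff_branchMap κ).differentiable (by simp) 0).hasFDerivAt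
  have h2 := h1.comp (0 : ℝ × Ell1) (ContinuousLinearMap.inr ℝ ℝ (ℝ × Ell1)).hasFDerivAt
  have h3 : branchMap κ ∘ (ContinuousLinearMap.inr ℝ ℝ (ℝ × Ell1))
      = fun y : ℝ × Ell1 => (y.1, y.2 - y.1 • G (M y.2)) := by
    funext y
    simp [branchMap, scaledNonlin]
  rw [h3] at h2
  refine h2.unique ?_
  have hf : HasFDerivAt (fun y : ℝ × Ell1 => y.1) (ContinuousLinearMap.fst ℝ ℝ Ell1) 0 :=
    hasFDerivAt_fst
  have hs : HasFDerivAt (fun y : ℝ × Ell1 => y.2) (ContinuousLinearMap.snd ℝ ℝ Ell1) 0 :=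
    hasFDerivAt_snd
  have hg : HasFDerivAt (fun y : ℝ × Ell1 => G (M y.2))
      ((G.comp M).comp (ContinuousLinearMap.snd ℝ ℝ Ell1)) 0 :=
    ((G.comp M).comp (ContinuousLinearMap.snd ℝ ℝ Ell1)).hasFDerivAt
  have h4 := hf.prodMk (hs.sub (hf.smul hg))
  convert! h4 using 1
  ext y <;> simp

theorem exists_implicit_branch (κ : ℕ) : ∃ ψ : ℝ → ℝ × Ell1, ψ 0 = 0 ∧
    (∀ᶠ s in 𝓝 (0 : ℝ), ContDiffAt ℝ (⊤ : WithTop ℕ∞) ψ s) ∧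
    (∀ᶠ s in 𝓝 (0 : ℝ), branchMap κ (s, ψ s) = 0) ∧
    ∀ᶠ v in 𝓝 (0 : ℝ × (ℝ × Ell1)), branchMap κ v = 0 → ψ v.1 = v.2 := by
  have cdf : ContDiffAt ℝ (⊤ : WithTop ℕ∞) (branchMap κ) 0 := (contDiff_branchMap κ).contDiffAt
  have hinv : ((fderiv ℝ (branchMap κ) 0) ∘L .inr ℝ ℝ (ℝ × Ell1)).IsInvertible := by
    rw [fderiv_branchMap_comp_inr]
    exact ⟨ContinuousLinearEquiv.refl ℝ _, rfl⟩
  have hn : (⊤ : WithTop ℕ∞) ≠ 0 := by simp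
  refine ⟨cdf.implicitFunction hn hinv, cdf.implicitFunction_apply_self hn hinv, ?_, ?_, ?_⟩
  · exact (cdf.contDiffAt_implicitFunction hn hinv).eventually (by simp)
  · have := cdf.eventually_apply_implicitFunction hn hinv
    rwa [branchMap_zero] at this
  · have := cdf.eventually_apply_eq_iff_implicitFunction hn hinv
    rw [branchMap_zero] at this
    filter_upwards [this] with v hv using hv.1

variable {κ κ' d : ℕ}

theorem IsKernelPair.ratio_ne_zero (h : IsKernelPair κ κ' d) :
    ((κ : ℝ) - 1) / ((κ : ℝ) + 1) ≠ 0 := by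
  rcases h with ⟨rfl, rfl, rfl⟩ | ⟨rfl, rfl, rfl⟩ <;> norm_num

theorem IsKernelPair.apply_self (h : IsKernelPair κ κ' d) {w : Ell1} (h4 : w 4 = 0)
    (h11 : w 11 = 0) (s : ℝ) : (s • (e κ + w)) κ = s := by
  rcases h with ⟨rfl, rfl, rfl⟩ | ⟨rfl, rfl, rfl⟩ <;> simp [h4, h11]

theorem IsKernelPair.apply_other (h : IsKernelPair κ κ' d) {w : Ell1} (h4 : w 4 = 0)
    (h11 : w 11 = 0) (s : ℝ) : (s • (e κ + w)) κ' = 0 := by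
  rcases h with ⟨rfl, rfl, rfl⟩ | ⟨rfl, rfl, rfl⟩ <;> simp [h4, h11, e_apply]

theorem IsKernelPair.onKernel_eq (h : IsKernelPair κ κ' d) {a : Ell1} (ha : a κ' = 0) :
    onKernel a = a κ • e κ := by
  rcases h with ⟨rfl, rfl, rfl⟩ | ⟨rfl, rfl, rfl⟩ <;> simp [onKernel, ha]

theorem IsKernelPair.amplitude_eq (h : IsKernelPair κ κ' d) {a : Ell1} (ha : a κ' = 0) :
    amplitude a = |a κ| := by
  rcases h with ⟨rfl, rfl, rfl⟩ | ⟨rfl, rfl, rfl⟩ <;> simp [amplitude, ha]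

theorem IsKernelPair.offKernel_eq (h : IsKernelPair κ κ' d) {w : Ell1} (h4 : w 4 = 0)
    (h11 : w 11 = 0) (s : ℝ) : offKernel (s • (e κ + w)) = s • w := by
  have h1 := onKernel_add_offKernel (s • (e κ + w))
  rw [h.onKernel_eq (h.apply_other h4 h11 s), h.apply_self h4 h11] at h1
  exact add_left_cancel (h1.trans (smul_add s (e κ) w))

theorem IsKernelPair.of_branchMap_eq_zero (h : IsKernelPair κ κ' d) {s Δ : ℝ} {w : Ell1}
    (hb : branchMap κ (s, (Δ, w)) = 0) :
    w 4 = 0 ∧ w 11 = 0 ∧ Auxiliary Δ (s • (e κ + w)) ∧ Reduced κ Δ (s • (e κ + w)) := by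
  have h1 : Δ + (((κ : ℝ) - 1) / ((κ : ℝ) + 1))⁻¹ * scaledNonlin κ s w κ = 0 :=
    congrArg Prod.fst hb
  have h2 : w = G (Δ • M w + scaledNonlin κ s w) := sub_eq_zero.1 (congrArg Prod.snd hb)
  have h4 : w 4 = 0 := by rw [h2, G_apply_four]
  have h11 : w 11 = 0 := by rw [h2, G_apply_eleven]
  refine ⟨h4, h11, ?_, ?_⟩
  · rw [Auxiliary, h.offKernel_eq h4 h11, nonlin_smul, map_smul, smul_comm Δ s, ← smul_add,
      map_smul, ← h2]
  · rw [Reduced, h.apply_self h4 h11, nonlin_smul, smul_apply]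
    have hm := h.ratio_ne_zero
    have h5 := congrArg (fun t => ((κ : ℝ) - 1) / ((κ : ℝ) + 1) * t) h1
    simp only [mul_add, mul_zero, mul_inv_cancel_left₀ hm] at h5
    linear_combination s * h5

theorem IsKernelPair.branchMap_eq_zero (h : IsKernelPair κ κ' d) {Δ : ℝ} {a : Ell1}
    (hA : Auxiliary Δ a) (hR : Reduced κ Δ a) (ha' : a κ' = 0) (ha : a κ ≠ 0) :
    a = a κ • (e κ + (a κ)⁻¹ • offKernel a) ∧
      branchMap κ (a κ, (Δ, (a κ)⁻¹ • offKernel a)) = 0 := by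
  have h0 : a = a κ • (e κ + (a κ)⁻¹ • offKernel a) := by
    rw [smul_add, smul_inv_smul₀ ha, ← h.onKernel_eq ha', onKernel_add_offKernel]
  refine ⟨h0, ?_⟩
  obtain ⟨w, hw⟩ : ∃ w, w = (a κ)⁻¹ • offKernel a := ⟨_, rfl⟩
  obtain ⟨s, hs⟩ : ∃ s, s = a κ := ⟨_, rfl⟩
  have hwa : offKernel a = s • w := by rw [hw, hs, smul_inv_smul₀ ha]
  rw [← hw, ← hs] at h0 ⊢
  rw [← hs] at ha
  have hn : nonlin a = s • scaledNonlin κ s w := by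
    conv_lhs => rw [h0]
    exact nonlin_smul _ _ _
  refine Prod.ext ?_ ?_
  · change Δ + (((κ : ℝ) - 1) / ((κ : ℝ) + 1))⁻¹ * scaledNonlin κ s w κ = 0
    rw [Reduced, hn, ← hs, smul_apply] at hR
    have hm := h.ratio_ne_zero
    have h5 : s * (((κ : ℝ) - 1) / ((κ : ℝ) + 1))
        * (Δ + (((κ : ℝ) - 1) / ((κ : ℝ) + 1))⁻¹ * scaledNonlin κ s w κ) = 0 := by
      rw [mul_add, mul_assoc s _ (_ * _), mul_inv_cancel_left₀ hm]
      linear_combination hR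
    exact (mul_eq_zero.1 h5).resolve_left (mul_ne_zero ha hm)
  · change w - G (Δ • M w + scaledNonlin κ s w) = 0
    rw [Auxiliary, hn, hwa, map_smul, smul_comm Δ s, ← smul_add, map_smul] at hA
    exact sub_eq_zero.2 (smul_right_injective Ell1 ha hA)

/-- With no amplitude in mode κ', the kernel component lies in the class of 1 modulo d, and so does
the whole solution; the nonlinearity then has no component in κ'. -/
theorem IsKernelPair.reduced_other (h : IsKernelPair κ κ' d) {Δ : ℝ} {a : Ell1}
    (hA : Auxiliary Δ a) (ha' : a κ' = 0) (hΔ : |Δ| ≤ 1 / 800) (ha : ‖a‖ ≤ 1 / 14400) :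
    Reduced κ' Δ a := by
  have hd : d = 3 ∨ d = 10 := by
    rcases h with ⟨rfl, rfl, rfl⟩ | ⟨rfl, rfl, rfl⟩ <;> simp
  have hκ : κ % d = 1 := by
    rcases h with ⟨rfl, rfl, rfl⟩ | ⟨rfl, rfl, rfl⟩ <;> rfl
  have hκ' : κ' % d ≠ 1 := by
    rcases h with ⟨rfl, rfl, rfl⟩ | ⟨rfl, rfl, rfl⟩ <;> norm_num
  have h1 : offClass d (onKernel a) = 0 := by
    rw [h.onKernel_eq ha', map_smul, offClass_e, if_pos hκ, smul_zero]
  have h2 := hA.norm_offClass_le hd hΔ ha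
  rw [h1, norm_zero, mul_zero, mul_zero, norm_le_zero_iff] at h2
  have h3 : offClass d a = 0 := by
    rw [← onKernel_add_offKernel a, map_add, h1, h2, add_zero]
  have h4 := norm_offClass_nonlin_le hd (ha.trans (by norm_num) : ‖a‖ ≤ 1)
  rw [h3, norm_zero, mul_zero, mul_zero, norm_le_zero_iff] at h4
  have h5 := offClass_apply d (nonlin a) κ'
  rw [h4, if_neg hκ', zero_apply] at h5
  rw [Reduced, ha', ← h5]
  ring

theorem IsKernelPair.abs_le (h : IsKernelPair κ κ' d) {Δ : ℝ} {a : Ell1}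
    (hA : Auxiliary Δ a) (hR : Reduced κ Δ a) (ha' : a κ' = 0) (ha0 : a κ ≠ 0)
    (hΔ : |Δ| ≤ 1 / 800) (ha : ‖a‖ ≤ 1 / 10 ^ 14) : |Δ| ≤ 2 * a κ ^ 2 := by
  have hb : ‖a‖ ≤ 1 / 10 ^ 7 := ha.trans (by norm_num)
  have h1 := amplitude_le a
  have h2 := amplitude_nonneg a
  have h3 : amplitude a ^ 2 = a κ ^ 2 := by rw [h.amplitude_eq ha', sq_abs]
  have h4 : 10 ^ 12 * amplitude a ^ 3 ≤ a κ ^ 2 := by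
    have h5 : 10 ^ 12 * amplitude a ≤ 1 := by norm_num at ha; linarith
    calc 10 ^ 12 * amplitude a ^ 3 = (10 ^ 12 * amplitude a) * amplitude a ^ 2 := by ring
      _ ≤ 1 * amplitude a ^ 2 := by gcongr
      _ = _ := by rw [one_mul, h3]
  have h6 := sq_nonneg (a κ)
  rcases h with ⟨rfl, rfl, rfl⟩ | ⟨rfl, rfl, rfl⟩
  · have h5 := abs_le.1 ((hA.abs_sub_le_four hR ha0 hΔ hb).trans h4)
    rw [ha'] at h5
    rw [_root_.abs_le]
    constructor <;> linarith [h5.1, h5.2]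
  · have h5 := abs_le.1 ((hA.abs_sub_le_eleven hR ha0 hΔ hb).trans h4)
    rw [ha'] at h5
    rw [_root_.abs_le]
    constructor <;> linarith [h5.1, h5.2]

theorem IsKernelPair.exists_branch (h : IsKernelPair κ κ' d) :
    ∃ r > 0, ∃ η > 0, ∃ (Δ : ℝ → ℝ) (a : ℝ → Ell1),
      ContDiffOn ℝ (⊤ : WithTop ℕ∞) Δ (Set.Ioo (-r) r) ∧
      ContDiffOn ℝ (⊤ : WithTop ℕ∞) a (Set.Ioo (-r) r) ∧
      (∀ s ∈ Set.Ioo (-r) r, Auxiliary (Δ s) (a s) ∧ Reduced κ (Δ s) (a s) ∧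
        Reduced κ' (Δ s) (a s) ∧ a s κ = s ∧ a s κ' = 0 ∧ |Δ s| ≤ 1 / 800 ∧
        |Δ s| + ‖offKernel (a s)‖ ≤ 13000 * s ^ 2) ∧
      ∀ (Δ' : ℝ) (a' : Ell1), |Δ'| < η → ‖a'‖ < η → Auxiliary Δ' a' → Reduced κ Δ' a' →
        a' κ' = 0 → a' κ ≠ 0 → Δ' = Δ (a' κ) ∧ a' = a (a' κ) := by
  obtain ⟨ψ, hψ0, hsm, hsol, huniq⟩ := exists_implicit_branch κ
  have hcont : ContinuousAt ψ 0 := hsm.self_of_nhds.continuousAt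
  have hΔ : Tendsto (fun s => |(ψ s).1|) (𝓝 0) (𝓝 0) := by
    have : ContinuousAt (fun s => |(ψ s).1|) 0 := by fun_prop
    simpa [ContinuousAt, hψ0] using this
  have ha : Tendsto (fun s => ‖s • (e κ + (ψ s).2)‖) (𝓝 0) (𝓝 0) := by
    have : ContinuousAt (fun s => ‖s • (e κ + (ψ s).2)‖) 0 := by fun_prop
    simpa [ContinuousAt, hψ0] using this
  have hall := hsm.and (hsol.and ((hΔ.eventually_lt_const (by norm_num : (0 : ℝ) < 1 / 800)).and
    (ha.eventually_lt_const (by norm_num : (0 : ℝ) < 1 / 10 ^ 14))))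
  obtain ⟨r, hr, hball⟩ := Metric.eventually_nhds_iff.1 hall
  obtain ⟨ε, hε, hun⟩ := Metric.eventually_nhds_iff.1 huniq
  have hmem : ∀ s ∈ Set.Ioo (-r) r, dist s 0 < r := fun s hs => by
    rw [Real.dist_0_eq_abs]; exact abs_lt.2 hs
  refine ⟨r, hr, min (1 / 14400) (ε / 30000), by positivity, fun s => (ψ s).1,
    fun s => s • (e κ + (ψ s).2), ?_, ?_, ?_, ?_⟩
  · intro s hs
    exact ((hball (hmem s hs)).1.fst).contDiffWithinAt
  · intro s hs
    exact (contDiffAt_id.smul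
      (contDiffAt_const.add (hball (hmem s hs)).1.snd)).contDiffWithinAt
  · intro s hs
    obtain ⟨-, h1, h2, h3⟩ := hball (hmem s hs)
    obtain ⟨h4, h11, hA, hR⟩ := h.of_branchMap_eq_zero h1
    have hs1 := h.apply_self h4 h11 s
    have hs2 := h.apply_other h4 h11 s
    have h3' : ‖s • (e κ + (ψ s).2)‖ ≤ 1 / 14400 := h3.le.trans (by norm_num)
    refine ⟨hA, hR, h.reduced_other hA hs2 h2.le h3', hs1, hs2, h2.le, ?_⟩
    have h5 := hA.norm_offKernel_le_amplitude h2.le h3'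
    rw [h.amplitude_eq hs2, hs1, sq_abs] at h5
    have h6 : |(ψ s).1| ≤ 2 * s ^ 2 := by
      -- At s = 0 the reduced equation gives no information on Δ, and ψ 0 = 0 is used instead.
      by_cases h0 : s = 0
      · subst h0; simp [hψ0]
      · have := h.abs_le hA hR hs2 (by rwa [hs1]) h2.le h3.le
        rwa [hs1] at this
    -- 2 + 12800 ≤ 13000.
    linarith [sq_nonneg s]
  · intro Δ' a' hΔ' ha' hA hR hκ' hκ
    have e1 := min_le_left (1 / 14400 : ℝ) (ε / 30000)
    have e2 := min_le_right (1 / 14400 : ℝ) (ε / 30000)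
    obtain ⟨h1, h2⟩ := h.branchMap_eq_zero hA hR hκ' hκ
    have hκp : 0 < |a' κ| := abs_pos.2 hκ
    have hκle := abs_apply_le a' κ
    -- Local uniqueness concerns w = offKernel a' / a' κ, which is small because offKernel a' is
    -- quadratic in the amplitude.
    have h3 : ‖(a' κ)⁻¹ • offKernel a'‖ < ε := by
      have h4 := hA.norm_offKernel_le_amplitude (hΔ'.le.trans (by linarith))
        (ha'.le.trans e1)
      rw [h.amplitude_eq hκ'] at h4
      rw [norm_smul, norm_inv, Real.norm_eq_abs, inv_mul_lt_iff₀ hκp]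
      refine h4.trans_lt ?_
      have : 12800 * |a' κ| < ε := by linarith
      nlinarith
    have h5 := hun (y := (a' κ, (Δ', (a' κ)⁻¹ • offKernel a'))) (by
      rw [dist_zero_right, Prod.norm_def, Prod.norm_def, max_lt_iff, max_lt_iff]
      refine ⟨?_, ?_, h3⟩
      · rw [Real.norm_eq_abs]; linarith
      · rw [Real.norm_eq_abs]; linarith) h2
    simp only at h5
    refine ⟨(congrArg Prod.fst h5).symm, ?_⟩
    change a' = a' κ • (e κ + (ψ (a' κ)).2)
    rw [congrArg Prod.snd h5]
    exact h1

/-! ### Assembly in ℓ² -/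

theorem isSmoothBranch {r C : ℝ} {ε μ Δ : ℝ → ℝ} {a : ℝ → Ell1}
    (hΔ : ContDiffOn ℝ (⊤ : WithTop ℕ∞) Δ (Set.Ioo (-r) r))
    (ha : ContDiffOn ℝ (⊤ : WithTop ℕ∞) a (Set.Ioo (-r) r))
    (h : ∀ s ∈ Set.Ioo (-r) r, Stationary (1 / 15 + Δ s) (e 1 + a s) ∧ |Δ s| ≤ 1 / 800 ∧
      a s 4 = ε s ∧ a s 11 = μ s ∧ |Δ s| + ‖offKernel (a s)‖ ≤ C * (ε s ^ 2 + μ s ^ 2)) :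
    IsSmoothBranch r C ε μ (fun s => 1 / 15 + Δ s) (fun s => toEll2 (e 1 + a s)) where
  smooth_ω := (contDiffOn_const.add hΔ).of_le le_top
  smooth_A := (toEll2.contDiff.comp_contDiffOn (contDiffOn_const.add ha)).of_le le_top
  stationary s hs := by
    obtain ⟨h1, h2, -⟩ := h s hs
    exact h1.isStationaryState (by linarith [(abs_le.1 h2).1])
  mode_four s hs := by
    rw [toEll2_apply, add_apply, (h s hs).2.2.1]; simp [e_apply]
  mode_eleven s hs := by
    rw [toEll2_apply, add_apply, (h s hs).2.2.2.1]; simp [e_apply]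
  bound s hs := by
    obtain ⟨-, -, h4, h11, hb⟩ := h s hs
    -- The sequence in the supremum is the off-kernel part of the perturbation, bounded by its ℓ¹
    -- norm.
    refine le_trans (add_le_add ?_ (ciSup_le fun n => ?_)) hb
    · simp
    · have h5 : toEll2 (e 1 + a s) n - kronecker n 1 - ε s * kronecker n 4 - μ s * kronecker n 11
          = offKernel (a s) n := by
        rw [toEll2_apply, ← h4, ← h11]
        simp only [offKernel, add_apply, sub_apply, smul_apply, e_apply, kronecker]
        ring
      rw [h5]
      exact abs_apply_le _ _

end Ell1

open Ell1 in
theorem mainTheorem5 :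
    ∃ (C r η : ℝ) (ω₁ ω₂ : ℝ → ℝ) (A₁ A₂ : ℝ → Ell2),
      0 < r ∧ 0 < η ∧
      -- branch (i): ε = 0, parameterized by μ
      IsSmoothBranch r C (fun _ => 0) (fun μ => μ) ω₁ A₁ ∧
      -- branch (ii): μ = 0, parameterized by ε
      IsSmoothBranch r C (fun ε => ε) (fun _ => 0) ω₂ A₂ ∧
      -- near the bifurcation point there are no other solutions but the second eigenmode itself
      (∀ (ω : ℝ) (A : Ell2), |ω - 1 / 15| < η → ‖A - secondMode‖ < η →
        (IsStationaryState (1 + ω) ω A ↔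
          A = secondMode ∨
          (∃ μ ∈ Set.Ioo (-r) r, μ ≠ 0 ∧ ω = ω₁ μ ∧ A = A₁ μ) ∨
          (∃ ε ∈ Set.Ioo (-r) r, ε ≠ 0 ∧ ω = ω₂ ε ∧ A = A₂ ε))) ∧
      -- in particular no solution near the bifurcation point has ε ≠ 0 and μ ≠ 0
      (∀ (ω : ℝ) (A : Ell2), |ω - 1 / 15| < η → ‖A - secondMode‖ < η →
        IsStationaryState (1 + ω) ω A → ¬ (A 4 ≠ 0 ∧ A 11 ≠ 0)) := by

  have hk₁ : IsKernelPair 11 4 10 := Or.inr ⟨rfl, rfl, rfl⟩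
  have hk₂ : IsKernelPair 4 11 3 := Or.inl ⟨rfl, rfl, rfl⟩
  obtain ⟨r₁, hr₁, η₁, hη₁, Δ₁, a₁, hΔ₁, ha₁, hb₁, hu₁⟩ := hk₁.exists_branch
  obtain ⟨r₂, hr₂, η₂, hη₂, Δ₂, a₂, hΔ₂, ha₂, hb₂, hu₂⟩ := hk₂.exists_branch
  obtain ⟨r, hr⟩ : ∃ r, r = min r₁ r₂ := ⟨_, rfl⟩
  have hrp : 0 < r := by rw [hr]; positivity
  have hsub₁ : Set.Ioo (-r) r ⊆ Set.Ioo (-r₁) r₁ := by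
    have : r ≤ r₁ := hr ▸ min_le_left _ _
    exact Set.Ioo_subset_Ioo (by linarith) this
  have hsub₂ : Set.Ioo (-r) r ⊆ Set.Ioo (-r₂) r₂ := by
    have : r ≤ r₂ := hr ▸ min_le_right _ _
    exact Set.Ioo_subset_Ioo (by linarith) this
  obtain ⟨ρ, hρ⟩ : ∃ ρ : ℝ, ρ = min (min η₁ η₂) (min r (1 / 10 ^ 14)) := ⟨_, rfl⟩
  have hρp : 0 < ρ := by rw [hρ]; positivity
  have hρ₁ : ρ ≤ η₁ := hρ ▸ (min_le_left _ _).trans (min_le_left _ _)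
  have hρ₂ : ρ ≤ η₂ := hρ ▸ (min_le_left _ _).trans (min_le_right _ _)
  have hρr : ρ ≤ r := hρ ▸ (min_le_right _ _).trans (min_le_left _ _)
  have hρ0 : ρ ≤ 1 / 10 ^ 14 := hρ ▸ (min_le_right _ _).trans (min_le_right _ _)
  obtain ⟨δ, hδ, hnear⟩ := exists_near_of_isStationaryState hρp
  have key : ∀ (ω : ℝ) (A : Ell2), |ω - 1 / 15| < min δ ρ → ‖A - secondMode‖ < min δ ρ →
      IsStationaryState (1 + ω) ω A → ∃ a : Ell1, A = toEll2 (e 1 + a) ∧ ‖a‖ < ρ ∧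
        Auxiliary (ω - 1 / 15) a ∧ Reduced 4 (ω - 1 / 15) a ∧ Reduced 11 (ω - 1 / 15) a ∧
        ¬ (a 4 ≠ 0 ∧ a 11 ≠ 0) := by
    intro ω A hω hA hst
    obtain ⟨x, rfl, hx, hxn⟩ := hnear ω A (hω.trans_le (min_le_left _ _))
      (hA.trans_le (min_le_left _ _)) hst
    have hω' := hω.trans_le (min_le_right δ ρ)
    have hx' : Stationary (1 / 15 + (ω - 1 / 15)) (e 1 + (x - e 1)) := by
      rwa [add_sub_cancel, add_sub_cancel]
    obtain ⟨h1, h2, h3⟩ := (lyapunovSchmidt _ _).1 hx'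
    refine ⟨x - e 1, by rw [add_sub_cancel], hxn, h1, h2, h3, ?_⟩
    exact h1.not_mixed h2 h3 (hω'.le.trans (hρ0.trans (by norm_num))) (hxn.le.trans hρ0)
  have hB₁ : IsSmoothBranch r 13000 (fun _ => 0) (fun μ => μ) (fun s => 1 / 15 + Δ₁ s)
      (fun s => toEll2 (e 1 + a₁ s)) := by
    refine isSmoothBranch (hΔ₁.mono hsub₁) (ha₁.mono hsub₁) fun s hs => ?_
    obtain ⟨h1, h2, h3, h4, h5, h6, h7⟩ := hb₁ s (hsub₁ hs)
    exact ⟨(lyapunovSchmidt _ _).2 ⟨h1, h3, h2⟩, h6, h5, h4, h7.trans (by simp)⟩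
  have hB₂ : IsSmoothBranch r 13000 (fun ε => ε) (fun _ => 0) (fun s => 1 / 15 + Δ₂ s)
      (fun s => toEll2 (e 1 + a₂ s)) := by
    refine isSmoothBranch (hΔ₂.mono hsub₂) (ha₂.mono hsub₂) fun s hs => ?_
    obtain ⟨h1, h2, h3, h4, h5, h6, h7⟩ := hb₂ s (hsub₂ hs)
    exact ⟨(lyapunovSchmidt _ _).2 ⟨h1, h2, h3⟩, h6, h4, h5, h7.trans (by simp)⟩
  refine ⟨13000, r, min δ ρ, _, _, _, _, hrp, by positivity, hB₁, hB₂, ?_, ?_⟩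
  · intro ω A hω hA
    have hωρ : |ω - 1 / 15| < ρ := hω.trans_le (min_le_right δ ρ)
    constructor
    · intro hst
      obtain ⟨a, rfl, han, h1, h2, h3, h4⟩ := key ω A hω hA hst
      have hmem : ∀ κ, a κ ∈ Set.Ioo (-r) r := fun κ =>
        abs_lt.1 (((abs_apply_le a κ).trans_lt han).trans_le hρr)
      by_cases h5 : a 4 = 0
      · by_cases h6 : a 11 = 0
        · left
          -- With both amplitudes zero, the bound of the norm by the amplitude leaves only a = 0.
          have h7 := h1.norm_le_amplitude (hωρ.le.trans (hρ0.trans (by norm_num)))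
            (han.le.trans (hρ0.trans (by norm_num)))
          rw [amplitude, h5, h6, abs_zero, add_zero, mul_zero, norm_le_zero_iff] at h7
          rw [h7, add_zero, toEll2_e_one]
        · right; left
          obtain ⟨h7, h8⟩ := hu₁ _ _ (hωρ.trans_le hρ₁) (han.trans_le hρ₁) h1 h3 h5 h6
          exact ⟨a 11, hmem 11, h6, by rw [← h7]; ring, by rw [← h8]⟩
      · right; right
        have h6 : a 11 = 0 := by
          by_contra h6
          exact h4 ⟨h5, h6⟩
        obtain ⟨h7, h8⟩ := hu₂ _ _ (hωρ.trans_le hρ₂) (han.trans_le hρ₂) h1 h2 h6 h5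
        exact ⟨a 4, hmem 4, h5, by rw [← h7]; ring, by rw [← h8]⟩
    · rintro (rfl | ⟨μ, hμ, -, rfl, rfl⟩ | ⟨ε, hε, -, rfl, rfl⟩)
      · rw [← toEll2_e_one]
        have h0 : |ω - 1 / 15| < 1 / 15 := hωρ.trans_le (hρ0.trans (by norm_num))
        exact (stationary_e_one ω).isStationaryState (by linarith [(abs_lt.1 h0).1])
      · exact hB₁.stationary μ hμ
      · exact hB₂.stationary ε hε
  · intro ω A hω hA hst
    obtain ⟨a, rfl, -, -, -, -, h4⟩ := key ω A hω hA hst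
    rw [toEll2_apply, toEll2_apply, add_apply, add_apply]
    simpa [e_apply] using h4
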